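/- Let $\Gamma\subset\mathbb C$ be a lattice, let $g_2=60\sum_{u\in\Gamma\setminus\{0\}}u^{-4}$ and $g_3=140\sum_{u\in\Gamma\setminus\{0\}}u^{-6}$, and let $\wp(z;\Gamma)=z^{-2}+\sum_{u\in\Gamma\setminus\{0\}}\bigl((z-u)^{-2}-u^{-2}\bigr)$. For complex numbers $e_1,e_2,e_3$ write $(f_1,\{f_2,f_3\})=\mathscr L(e_1,\{e_2,e_3\})$ if $$f_1=-\tfrac{e_1}{2},\qquad f_1+f_2+f_3=0,\qquad 16(f_2-f_1)(f_3-f_1)=(e_2-e_3)^2 .$$ Let $e_1^{(0)},e_2^{(0)},e_3^{(0)}$ be the three distinct roots of $4x^3-g_2x-g_3$, ordered so that $|e_2^{(0)}-e_3^{(0)}|\le|e_1^{(0)}-e_3^{(0)}|\le|e_1^{(0)}-e_2^{(0)}|$. Put $(e_1^{(1)},\{e_2^{(1)},e_3^{(1)}\})=\mathscr L(e_1^{(0)},\{e_2^{(0)},e_3^{(0)}\})$. For $n\ge1$, list the numbers $e_1^{(n)},e_2^{(n)},e_3^{(n)}$ as $(h_1,h_2,h_3)$, where $h_1$ is chosen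 so that $|h_2-h_3|\le\min\{|h_1-h_2|,|h_1-h_3|\}$, and put $(e_1^{(n+1)},\{e_2^{(n+1)},e_3^{(n+1)}\})=\mathscr L(h_1,\{h_2,h_3\})$. For $n,N\ge1$ let $$\phi_n(x)=x+\frac{(e_2^{(n)}-e_1^{(n)})(e_3^{(n)}-e_1^{(n)})}{x-e_1^{(n)}},\qquad \Phi_N=\phi_1\circ\dots\circ\phi_N,\qquad \omega_N=\frac{i\pi}{\sqrt{3e_1^{(N)}}},$$ with either value of the square root. Let $z\notin\Gamma$ and $$x_N=\frac{\pi^2}{\omega_N^2}\left(\frac1{\sin^2(\pi z/\omega_N)}-\frac13\right).$$ Then for all sufficiently large $N$ the numbers $\omega_N$, $x_N$ and $\Phi_N(x_N)$ are well defined and finite, with $\omega_N\ne0$ and no pole met when $\phi_N,\phi_{N-1},\dots,\phi_1$ are applied successively to $x_N$. Moreover $\Phi_N(x_N)$ converges to $\wp(z;\Gamma)$ quadratically fast: there are $C,q>0$ such that $|\Phi_N(x_N)-\wp(z;\Gamma)|\le C\exp(-q2^N)$ for all $N\ge 1$ for which $\Phi_N(x_N)$ is finite. -/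

import Mathlib

namespace WeierstrassLanden

/-- A triple of complex numbers in which the first one is distinguished. The order of the last two
never matters below. -/
@[ext]
structure Triple where
  e₁ : ℂ
  e₂ : ℂ
  e₃ : ℂ

namespace Triple

/-- `e` lists the three distinct roots of `4 x ^ 3 - g₂ x - g₃`. -/
def IsDistinctRoots (e : Triple) (g₂ g₃ : ℂ) : Prop :=
  e.e₁ ≠ e.e₂ ∧ e.e₁ ≠ e.e₃ ∧ e.e₂ ≠ e.e₃ ∧
    4 * e.e₁ ^ 3 - g₂ * e.e₁ - g₃ = 0 ∧
    4 * e.e₂ ^ 3 - g₂ * e.e₂ - g₃ = 0 ∧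
    4 * e.e₃ ^ 3 - g₂ * e.e₃ - g₃ = 0

/-- A properly ordered triple: `|e₂ - e₃| ≤ |e₁ - e₃| ≤ |e₁ - e₂|`. -/
def IsProperlyOrdered (e : Triple) : Prop :=
  ‖e.e₂ - e.e₃‖ ≤ ‖e.e₁ - e.e₃‖ ∧ ‖e.e₁ - e.e₃‖ ≤ ‖e.e₁ - e.e₂‖

/-- `f = 𝓛 (e₁, {e₂, e₃})`, the Landen transformation of triples. It determines `f` up to the
transposition of `f₂` and `f₃`. -/
def IsLanden (e f : Triple) : Prop :=
  f.e₁ = -e.e₁ / 2 ∧ f.e₁ + f.e₂ + f.e₃ = 0 ∧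
    16 * ((f.e₂ - f.e₁) * (f.e₃ - f.e₁)) = (e.e₂ - e.e₃) ^ 2

/-- `g` is a reordering of `f` whose distinguished entry is the one opposite to a shortest side of
the triangle with vertices `f₁, f₂, f₃`. Such a `g` always exists; if the shortest side is unique,
its distinguished entry is unique. -/
def IsSelection (f g : Triple) : Prop :=
  ({g.e₁, g.e₂, g.e₃} : Multiset ℂ) = {f.e₁, f.e₂, f.e₃} ∧
    ‖g.e₂ - g.e₃‖ ≤ ‖g.e₁ - g.e₂‖ ∧ ‖g.e₂ - g.e₃‖ ≤ ‖g.e₁ - g.e₃‖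

/-- One step of the optimal iteration: forget the distinguished entry of `f`, distinguish the entry
opposite to the shortest side, and apply the Landen transformation. -/
def IsOptimalLanden (f f' : Triple) : Prop :=
  ∃ g : Triple, f.IsSelection g ∧ g.IsLanden f'

/-- The inverse Landen map `φ(x) = x + (e₂ - e₁)(e₃ - e₁) / (x - e₁)`, meaningful for `x ≠ e₁`. -/
noncomputable def phi (e : Triple) (x : ℂ) : ℂ :=
  x + (e.e₂ - e.e₁) * (e.e₃ - e.e₁) / (x - e.e₁)

end Triple

/-- The sequence of triples computed from `(g₂, g₃)`: `e 0` is a properly ordered triple of the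
distinct roots, `e 1 = 𝓛 (e 0)`, and each later triple comes from the previous one by an optimal
step. Every labelling and every resolution of a tie is allowed. -/
structure IsLandenSequence (g₂ g₃ : ℂ) (e : ℕ → Triple) : Prop where
  roots : (e 0).IsDistinctRoots g₂ g₃
  proper : (e 0).IsProperlyOrdered
  first : (e 0).IsLanden (e 1)
  step : ∀ n, 1 ≤ n → (e n).IsOptimalLanden (e (n + 1))

/-- `w = iπ / √(3 e₁)` for one of the two values of the square root. -/
def IsApproxPeriod (e : Triple) (w : ℂ) : Prop :=
  ∃ s : ℂ, s ^ 2 = 3 * e.e₁ ∧ w = Complex.I * Real.pi / s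

/-- The `℘`-function of the rank-one group `w ℤ`, in elementary form. -/
noncomputable def rankOneP (w z : ℂ) : ℂ :=
  (Real.pi : ℂ) ^ 2 / w ^ 2 * (1 / Complex.sin (Real.pi * z / w) ^ 2 - 1 / 3)

/-- The composite `Φ_N = φ₁ ∘ ⋯ ∘ φ_N`. -/
noncomputable def Phi (e : ℕ → Triple) : ℕ → ℂ → ℂ
  | 0 => id
  | N + 1 => Phi e N ∘ (e (N + 1)).phi

/-- No pole is met when `φ_N`, then `φ_{N-1}`, …, then `φ₁` are applied to `x`; that is, `Φ_N(x)` is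
a finite complex number and no division by zero enters its evaluation. -/
def PhiFiniteAt (e : ℕ → Triple) : ℕ → ℂ → Prop
  | 0, _ => True
  | N + 1, x => x ≠ (e (N + 1)).e₁ ∧ PhiFiniteAt e N ((e (N + 1)).phi x)

/-- The sequence `a` converges to `l` quadratically fast. -/
def ConvergesQuadratically (a : ℕ → ℂ) (l : ℂ) : Prop :=
  Filter.Tendsto a Filter.atTop (nhds l) ∧
    ∃ C q : ℝ, 0 < C ∧ 0 < q ∧ ∀ n : ℕ, ‖a n - l‖ ≤ C * Real.exp (-q * 2 ^ n)

end WeierstrassLanden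

/-! In the coordinate `x = e₁ + p / q` each `φ` becomes a quadratic polynomial map of `(p, q)`. It
differs from `(p, q) ↦ (p ^ 2, p * q)`, which is projectively the identity, by terms controlled by
the increments of `e₁` and by the products `sideProd`. Both are doubly exponentially small, because
an optimal step makes the new short side quadratically small while the distinguished entry hardly
moves (`Triple.IsLanden.step_bounds`, `IsLandenSequence.exists_bounds`). Started at `(1, sinh² (s z)
/ s²)` with `s ^ 2 = 3 * e₁`, which represents the rank-one `℘`, the composites therefore converge
doubly exponentially and locally uniformly in `z` to entire functions `P`, `Q` without common zeros
(`towerBounded`, `exists_tower_limit`).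

The limit is identified by its differential equation. The map `φ` is a 2-isogeny preserving the
differential `dx / y`: one step multiplies the Wronskian of `p`, `q` by `p ^ 2 - α * q ^ 2`, where
`α` is the `sideProd` of the step, and the homogenised cubic by the square of this factor
(`Triple.IsLanden.cubic_identity`). The starting point violates the equation only by a multiple of
`α`, and this defect dies out. So `e₁ + P / Q` at level zero solves the equation of `℘` with its
pole at the origin. Its shifted reciprocal `Q / P` is regular there and unique
(`eventuallyEq_of_ode`), and the identity theorem spreads the equality over the complement of the
lattice (`weierstrassP_eq_of_ode`). Off the lattice `Q` cannot vanish, which gives the absence of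
poles for large `N`. Lattices attached to the intermediate triples never enter. -/

namespace WeierstrassLanden

open Filter Topology

/-! ### One Landen step: the isogeny identity and metric estimates. -/

namespace Triple

/-- The product `(e₂ - e₁) (e₃ - e₁)`. -/
noncomputable def sideProd (e : Triple) : ℂ := (e.e₂ - e.e₁) * (e.e₃ - e.e₁)

theorem IsSelection.perm {f g : Triple} (h : f.IsSelection g) :
    (g.e₁ = f.e₁ ∧ g.e₂ = f.e₂ ∧ g.e₃ = f.e₃) ∨ (g.e₁ = f.e₁ ∧ g.e₂ = f.e₃ ∧ g.e₃ = f.e₂) ∨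
    (g.e₁ = f.e₂ ∧ g.e₂ = f.e₁ ∧ g.e₃ = f.e₃) ∨ (g.e₁ = f.e₂ ∧ g.e₂ = f.e₃ ∧ g.e₃ = f.e₁) ∨
    (g.e₁ = f.e₃ ∧ g.e₂ = f.e₁ ∧ g.e₃ = f.e₂) ∨ (g.e₁ = f.e₃ ∧ g.e₂ = f.e₂ ∧ g.e₃ = f.e₁) := by
  have pair : ∀ {a b c d : ℂ}, ({a, b} : Multiset ℂ) = {c, d} →
      (a = c ∧ b = d) ∨ (a = d ∧ b = c) := by
    intro a b c d h
    have ha : a ∈ ({c, d} : Multiset ℂ) := h ▸ by simp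
    simp only [Multiset.insert_eq_cons, Multiset.mem_cons, Multiset.mem_singleton] at ha h
    rcases ha with rfl | rfl
    · left; simpa using h
    · right
      have h' : a ::ₘ {b} = a ::ₘ ({c} : Multiset ℂ) := h.trans (Multiset.pair_comm c a)
      simpa using h'
  have h1 := h.1
  have hm : g.e₁ ∈ ({f.e₁, f.e₂, f.e₃} : Multiset ℂ) := h1 ▸ by simp
  simp only [Multiset.insert_eq_cons, Multiset.mem_cons, Multiset.mem_singleton] at hm
  simp only [Multiset.insert_eq_cons] at h1 pair
  rcases hm with hm | hm | hm
  · rw [hm] at h1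
    have := pair ((Multiset.cons_inj_right _).1 h1)
    tauto
  · rw [hm, Multiset.cons_swap f.e₁] at h1
    have := pair ((Multiset.cons_inj_right _).1 h1)
    tauto
  · have : (f.e₁ ::ₘ f.e₂ ::ₘ {f.e₃} : Multiset ℂ) = f.e₃ ::ₘ f.e₁ ::ₘ {f.e₂} := by
      rw [Multiset.cons_swap f.e₃]
      exact congrArg _ (Multiset.pair_comm _ _)
    rw [hm, this] at h1
    have := pair ((Multiset.cons_inj_right _).1 h1)
    tauto

/-- The cubic with roots `e₁, e₂, e₃` of sum zero, in the coordinate `x = f₁ + p / q` of the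
Landen transform `f`, after clearing denominators. -/
theorem IsLanden.cubic_identity {e g f : Triple} (he : e.e₁ + e.e₂ + e.e₃ = 0)
    (hg : e.IsSelection g) (hf : g.IsLanden f) {p q p' q' : ℂ}
    (hp : p' = p ^ 2 + (f.e₁ - e.e₁) * p * q + f.sideProd * q ^ 2) (hq : q' = p * q) :
    p' * q' * (p' ^ 2 + 3 * e.e₁ * p' * q' + e.sideProd * q' ^ 2) =
      (p ^ 2 - f.sideProd * q ^ 2) ^ 2 *
        (p * q * (p ^ 2 + 3 * f.e₁ * p * q + f.sideProd * q ^ 2)) := by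
  obtain ⟨hf1, -, hf3⟩ := hf
  rw [mul_comm (f.e₂ - f.e₁)] at hf3
  have hs : f.sideProd = (g.e₂ - g.e₃) ^ 2 / 16 := by
    rw [sideProd, ← hf3]; ring
  have h3 : e.e₃ = -e.e₁ - e.e₂ := by linear_combination he
  have hsum : g.e₁ + g.e₂ + g.e₃ = 0 := by
    rcases hg.perm with ⟨h1, h2, h3⟩ | ⟨h1, h2, h3⟩ | ⟨h1, h2, h3⟩ | ⟨h1, h2, h3⟩ | ⟨h1, h2, h3⟩ |
      ⟨h1, h2, h3⟩ <;> rw [h1, h2, h3, ← he] <;> ring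
  -- A selection only permutes the roots, so the cubic is common to `e` and `g`, although `e₁` and
  -- `sideProd` may change.
  have hprod : ∀ x : ℂ, (x - e.e₁) * (x - e.e₂) * (x - e.e₃) =
      (x - g.e₁) * (x - g.e₂) * (x - g.e₃) := by
    intro x
    rcases hg.perm with ⟨h1, h2, h3⟩ | ⟨h1, h2, h3⟩ | ⟨h1, h2, h3⟩ | ⟨h1, h2, h3⟩ | ⟨h1, h2, h3⟩ |
      ⟨h1, h2, h3⟩ <;> rw [h1, h2, h3] <;> ring
  have h0 := hprod 0
  have h1 := hprod 1
  have hg1 : g.e₁ = -g.e₂ - g.e₃ := by linear_combination hsum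
  have hg2 : e.e₁ * e.e₂ + e.e₁ * e.e₃ + e.e₂ * e.e₃ =
      g.e₁ * g.e₂ + g.e₁ * g.e₃ + g.e₂ * g.e₃ := by
    linear_combination h1 - h0 + he - hsum
  have hg3 : e.e₁ * e.e₂ * e.e₃ = g.e₁ * g.e₂ * g.e₃ := by linear_combination -h0
  have key : p' * (p' ^ 2 + 3 * e.e₁ * p' * q' + e.sideProd * q' ^ 2) =
      ((p' + e.e₁ * q') - g.e₁ * q') * ((p' + e.e₁ * q') - g.e₂ * q') *
        ((p' + e.e₁ * q') - g.e₃ * q') := by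
    have : p' * (p' ^ 2 + 3 * e.e₁ * p' * q' + e.sideProd * q' ^ 2) =
      ((p' + e.e₁ * q') - e.e₁ * q') * ((p' + e.e₁ * q') - e.e₂ * q') *
        ((p' + e.e₁ * q') - e.e₃ * q') := by
      rw [sideProd, h3]; ring
    rw [this]
    linear_combination (-(p' + e.e₁ * q') ^ 2 * q') * (he - hsum) +
      (p' + e.e₁ * q') * q' ^ 2 * hg2 - q' ^ 3 * hg3
  have hx : p' + e.e₁ * q' = p ^ 2 + f.e₁ * p * q + f.sideProd * q ^ 2 := by rw [hp, hq]; ring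
  -- As `f₁ = -g₁ / 2` and `f.sideProd = ((g₂ - g₃) / 4) ^ 2`, the factor at `g₁` is the quadratic
  -- on the right, while those at `g₂`, `g₃` are the perfect squares `(p ∓ (g₂ - g₃) * q / 4) ^ 2`.
  rw [mul_right_comm, key, hx, hq, hs, hf1, hg1]
  ring

/-- The parallelogram law gives the constant `√3`, and `17 / 10 < √3`. With `a = e₁ - e₃`, `b = e₁ -
e₂` the sum is `3 * e₁`. -/
theorem parallelogram_lower {a b : ℂ} (ha : ‖a - b‖ ≤ ‖a‖) (hb : ‖a - b‖ ≤ ‖b‖) :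
    17 / 10 * ‖a - b‖ ≤ ‖a + b‖ := by
  have h := parallelogram_law_with_norm ℝ a b
  have h0 := norm_nonneg (a - b)
  refine le_of_sq_le_sq ?_ (norm_nonneg _)
  nlinarith

/-- One optimal step: the short side shrinks quadratically while the distinguished entry hardly
moves. -/
theorem IsLanden.step_bounds {h f g : Triple} (hl : h.IsLanden f)
    (hs : f.IsSelection g) (hT : 17 / 10 * ‖h.e₂ - h.e₃‖ ≤ ‖3 * h.e₁‖)
    (hpos : 0 < ‖h.e₂ - h.e₃‖) :
    9 * ‖g.e₂ - g.e₃‖ ≤ ‖h.e₂ - h.e₃‖ ∧ ‖3 * g.e₁ - 3 * h.e₁‖ = 3 * ‖g.e₂ - g.e₃‖ ∧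
      ‖g.e₂ - g.e₃‖ * (‖3 * h.e₁‖ / 2 - ‖h.e₂ - h.e₃‖ / 4) ≤ ‖h.e₂ - h.e₃‖ ^ 2 / 16 := by
  -- Here `u`, `v` are the two sides of `f` at `f₁`, with known product and sum; the smaller one is
  -- the product divided by something close to the sum.
  have main : ∀ u v : ℂ, 16 * (u * v) = (h.e₂ - h.e₃) ^ 2 → u + v = 3 * h.e₁ / 2 →
      ‖v‖ ≤ ‖u‖ → 9 * ‖v‖ ≤ ‖h.e₂ - h.e₃‖ ∧
        ‖v‖ * (‖3 * h.e₁‖ / 2 - ‖h.e₂ - h.e₃‖ / 4) ≤ ‖h.e₂ - h.e₃‖ ^ 2 / 16 := by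
    intro u v huv hadd hle
    have h1 : 16 * (‖u‖ * ‖v‖) = ‖h.e₂ - h.e₃‖ ^ 2 := by
      simpa using congrArg norm huv
    have h2 : ‖3 * h.e₁‖ / 2 ≤ ‖u‖ + ‖v‖ := by
      calc ‖3 * h.e₁‖ / 2 = ‖u + v‖ := by rw [hadd]; simp
        _ ≤ _ := norm_add_le _ _
    have hv := norm_nonneg v
    have hv4 : ‖v‖ ≤ ‖h.e₂ - h.e₃‖ / 4 := by
      refine le_of_sq_le_sq ?_ (by positivity)
      nlinarith
    have h3 : ‖v‖ * (‖3 * h.e₁‖ / 2 - ‖h.e₂ - h.e₃‖ / 4) ≤ ‖h.e₂ - h.e₃‖ ^ 2 / 16 := by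
      nlinarith
    refine ⟨?_, h3⟩
    -- `17 / 20 - 1 / 4 = 3 / 5`, and `16 * 3 / 5 > 9`.
    have h4 : ‖v‖ * (3 / 5 * ‖h.e₂ - h.e₃‖) ≤ ‖h.e₂ - h.e₃‖ ^ 2 / 16 :=
      (mul_le_mul_of_nonneg_left (by linarith) hv).trans h3
    by_contra! hcon
    nlinarith
  obtain ⟨h1, h2, h3⟩ := hl
  have hadd : (f.e₂ - f.e₁) + (f.e₃ - f.e₁) = 3 * h.e₁ / 2 := by
    linear_combination h2 - 3 * h1
  have hadd' : (f.e₃ - f.e₁) + (f.e₂ - f.e₁) = 3 * h.e₁ / 2 := by rw [← hadd]; ring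
  have h3' : 16 * ((f.e₃ - f.e₁) * (f.e₂ - f.e₁)) = (h.e₂ - h.e₃) ^ 2 := by rw [← h3]; ring
  -- The side opposite `f₁` is never shortest: otherwise the larger side at `f₁` is at most twice
  -- the smaller one, and their sum would be too small to be `3 * h.e₁ / 2`.
  have big : ‖f.e₂ - f.e₃‖ ≤ ‖f.e₁ - f.e₂‖ → ‖f.e₂ - f.e₃‖ ≤ ‖f.e₁ - f.e₃‖ → False := by
    intro ha hb
    rw [norm_sub_rev f.e₁] at ha hb
    have hd : ‖f.e₂ - f.e₃‖ ≤ ‖f.e₂ - f.e₁‖ := ha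
    have t1 := norm_add_le (f.e₂ - f.e₁) (f.e₃ - f.e₁)
    rw [hadd, norm_div] at t1
    have t2 : ‖f.e₂ - f.e₁‖ ≤ ‖f.e₂ - f.e₃‖ + ‖f.e₃ - f.e₁‖ := by
      simpa using norm_add_le (f.e₂ - f.e₃) (f.e₃ - f.e₁)
    have t3 : ‖f.e₃ - f.e₁‖ ≤ ‖f.e₂ - f.e₃‖ + ‖f.e₂ - f.e₁‖ := by
      simpa [norm_sub_rev f.e₃ f.e₂] using norm_add_le (f.e₃ - f.e₂) (f.e₂ - f.e₁)
    simp only [RCLike.norm_ofNat] at t1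
    rcases le_total ‖f.e₂ - f.e₁‖ ‖f.e₃ - f.e₁‖ with hle | hle
    · have := (main _ _ h3' hadd' hle).1
      linarith
    · have := (main _ _ h3 hadd hle).1
      linarith
  have h3f : f.e₃ = -f.e₁ - f.e₂ := by linear_combination h2
  have hh : h.e₁ = -2 * f.e₁ := by rw [h1]; ring
  obtain ⟨-, ha, hb⟩ := id hs
  have norm3 : ∀ x : ℂ, ‖3 * x‖ = 3 * ‖x‖ := fun x ↦ by simp
  rcases hs.perm with ⟨e1, e2, e3⟩ | ⟨e1, e2, e3⟩ | ⟨e1, e2, e3⟩ | ⟨e1, e2, e3⟩ | ⟨e1, e2, e3⟩ |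
      ⟨e1, e2, e3⟩ <;> rw [e1, e2, e3] at ha hb <;> rw [e1, e2, e3]
  · exact (big ha hb).elim
  · rw [norm_sub_rev f.e₃ f.e₂] at ha hb
    exact (big hb ha).elim
  · rw [norm_sub_rev f.e₁ f.e₃] at ha hb ⊢
    have := main _ _ h3 hadd ha
    refine ⟨this.1, ?_, this.2⟩
    rw [← mul_sub, norm3, ← norm_neg, hh, h3f]; ring_nf
  · have := main _ _ h3 hadd hb
    refine ⟨this.1, ?_, this.2⟩
    rw [← mul_sub, norm3, ← norm_neg, hh, h3f]; ring_nf
  · rw [norm_sub_rev f.e₁ f.e₂] at ha hb ⊢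
    have := main _ _ h3' hadd' ha
    refine ⟨this.1, ?_, this.2⟩
    rw [← mul_sub, norm3, ← norm_neg, hh, h3f]; ring_nf
  · have := main _ _ h3' hadd' hb
    refine ⟨this.1, ?_, this.2⟩
    rw [← mul_sub, norm3, ← norm_neg, hh, h3f]; ring_nf

end Triple

/-! ### Doubly exponential decay along a Landen sequence. -/

/-- The doubly exponentially small sequence `exp (-2 ^ n)`. -/
noncomputable def rate (n : ℕ) : ℝ := Real.exp (-2 ^ n)

theorem rate_pos (n : ℕ) : 0 < rate n := Real.exp_pos _

theorem rate_succ (n : ℕ) : rate (n + 1) = rate n ^ 2 := by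
  rw [rate, rate, ← Real.exp_nat_mul]; congr 1; push_cast; ring

theorem rate_le_one (n : ℕ) : rate n ≤ 1 := by
  rw [rate, Real.exp_le_one_iff, neg_nonpos]; positivity

theorem rate_succ_le (n : ℕ) : rate (n + 1) ≤ rate n := by
  rw [rate_succ]; nlinarith [rate_pos n, rate_le_one n]

theorem rate_zero_gt : 1 / 3 < rate 0 := by
  have h := Real.exp_one_lt_d9
  rw [rate, pow_zero, Real.exp_neg, one_div]
  exact inv_strictAnti₀ (Real.exp_pos _) (by linarith)

theorem rate_zero_lt : rate 0 < 2 / 5 := by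
  have h := Real.exp_one_gt_d9
  rw [rate, pow_zero, Real.exp_neg, show (2 / 5 : ℝ) = (5 / 2)⁻¹ by norm_num]
  exact inv_strictAnti₀ (by norm_num) (by linarith)

variable {g₂ g₃ : ℂ} {e : ℕ → Triple}

theorem IsLandenSequence.sum_eq_zero (he : IsLandenSequence g₂ g₃ e) :
    ∀ n, (e n).e₁ + (e n).e₂ + (e n).e₃ = 0
  | 0 => by
    obtain ⟨h12, h13, h23, r1, r2, r3⟩ := he.roots
    -- The combination of the root equations that eliminates `g₂` and `g₃` is the Vandermonde
    -- product times the sum of the roots.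
    apply mul_left_cancel₀ (sub_ne_zero.2 h23)
    apply mul_left_cancel₀ (sub_ne_zero.2 h13)
    apply mul_left_cancel₀ (sub_ne_zero.2 h12)
    linear_combination (1 / 4) * (((e 0).e₂ - (e 0).e₃) * r1 - ((e 0).e₁ - (e 0).e₃) * r2 +
      ((e 0).e₁ - (e 0).e₂) * r3)
  | 1 => he.first.2.1
  | n + 2 => by
    obtain ⟨g, -, hg⟩ := he.step (n + 1) (by omega)
    exact hg.2.1

/-- Proper ordering makes `e 0` a selection of itself, so the first step has the same form as all
others. -/
theorem IsLandenSequence.exists_selection (he : IsLandenSequence g₂ g₃ e) :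
    ∃ h : ℕ → Triple, h 0 = e 0 ∧ ∀ n, (e n).IsSelection (h n) ∧ (h n).IsLanden (e (n + 1)) := by
  have : ∀ n, ∃ g, (n = 0 → g = e 0) ∧ (e n).IsSelection g ∧ g.IsLanden (e (n + 1)) := by
    rintro (_ | n)
    · exact ⟨e 0, fun _ ↦ rfl, ⟨rfl, he.proper.1.trans he.proper.2, he.proper.1⟩, he.first⟩
    · obtain ⟨g, hg⟩ := he.step (n + 1) (by omega)
      exact ⟨g, by simp, hg⟩
  choose h h0 hs using this
  exact ⟨h, h0 0 rfl, hs⟩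

/-- The entries of the triples of a Landen sequence, and of their reorderings, are distinct. -/
theorem IsLandenSequence.pairwise_ne (he : IsLandenSequence g₂ g₃ e) :
    ∀ n, (e n).e₁ ≠ (e n).e₂ ∧ (e n).e₁ ≠ (e n).e₃ ∧ (e n).e₂ ≠ (e n).e₃ := by
  obtain ⟨h, h0, hh⟩ := he.exists_selection
  intro n
  induction n with
  | zero => exact ⟨he.roots.1, he.roots.2.1, he.roots.2.2.1⟩
  | succ n ih =>
    obtain ⟨f1, f2, f3⟩ := (hh n).2
    have s := he.sum_eq_zero n
    have hs : ((h n).e₁ ≠ (h n).e₂ ∧ (h n).e₁ ≠ (h n).e₃ ∧ (h n).e₂ ≠ (h n).e₃) ∧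
        (h n).e₁ + (h n).e₂ + (h n).e₃ = 0 := by
      rcases (hh n).1.perm with ⟨h1, h2, h3⟩ | ⟨h1, h2, h3⟩ | ⟨h1, h2, h3⟩ | ⟨h1, h2, h3⟩ |
        ⟨h1, h2, h3⟩ | ⟨h1, h2, h3⟩ <;> rw [h1, h2, h3, ← s] <;>
        exact ⟨by tauto, by ring⟩
    obtain ⟨hd, hs⟩ := hs
    have hne : ((e (n + 1)).e₂ - (e (n + 1)).e₁) * ((e (n + 1)).e₃ - (e (n + 1)).e₁) ≠ 0 := by
      intro h
      rw [h, mul_zero] at f3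
      exact hd.2.2 (sub_eq_zero.1 (pow_eq_zero_iff two_ne_zero |>.1 f3.symm))
    refine ⟨(sub_ne_zero.1 (left_ne_zero_of_mul hne)).symm,
      (sub_ne_zero.1 (right_ne_zero_of_mul hne)).symm, fun h23 ↦ ?_⟩
    -- If `f₂ = f₃`, the Landen relation reads `9 * h₁ ^ 2 = (h₂ - h₃) ^ 2`, and for sum zero the
    -- difference of the two sides is `4 * (h₁ - h₂) * (h₁ - h₃)`.
    have : ((h n).e₁ - (h n).e₂) * ((h n).e₁ - (h n).e₃) = 0 := by
      have e3 : (e (n + 1)).e₃ = (h n).e₁ / 4 := by linear_combination (f2 - h23 - f1) / 2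
      rw [h23, f1, e3] at f3
      have e1 : (h n).e₁ = -(h n).e₂ - (h n).e₃ := by linear_combination hs
      rw [e1] at f3 ⊢
      linear_combination f3 / 4
    rcases mul_eq_zero.1 this with h | h
    · exact hd.1 (sub_eq_zero.1 h)
    · exact hd.2.1 (sub_eq_zero.1 h)

theorem IsLandenSequence.selection_ne (he : IsLandenSequence g₂ g₃ e) {n : ℕ} {g : Triple}
    (hg : (e n).IsSelection g) : g.e₁ ≠ g.e₂ ∧ g.e₁ ≠ g.e₃ ∧ g.e₂ ≠ g.e₃ := by
  have := he.pairwise_ne n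
  rcases hg.perm with ⟨h1, h2, h3⟩ | ⟨h1, h2, h3⟩ | ⟨h1, h2, h3⟩ | ⟨h1, h2, h3⟩ |
    ⟨h1, h2, h3⟩ | ⟨h1, h2, h3⟩ <;> rw [h1, h2, h3] <;> tauto

theorem IsLandenSequence.sideProd_ne_zero (he : IsLandenSequence g₂ g₃ e) (n : ℕ) :
    (e n).sideProd ≠ 0 :=
  mul_ne_zero (sub_ne_zero.2 (he.pairwise_ne n).1.symm) (sub_ne_zero.2 (he.pairwise_ne n).2.1.symm)

/-- Along a Landen sequence the distinguished entries converge quadratically to a nonzero limit and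
the products `(e₂ - e₁) (e₃ - e₁)` tend quadratically to zero. -/
theorem IsLandenSequence.exists_bounds (he : IsLandenSequence g₂ g₃ e) :
    ∃ C c : ℝ, 0 < C ∧ 0 < c ∧ (∀ n, ‖(e (n + 1)).e₁ - (e n).e₁‖ ≤ C * rate n) ∧
      (∀ n, ‖(e n).sideProd‖ ≤ C * rate n) ∧ ∀ n, c ≤ ‖(e (n + 1)).e₁‖ := by
  obtain ⟨h, h0, hh⟩ := he.exists_selection
  set d : ℕ → ℝ := fun n ↦ ‖(h n).e₂ - (h n).e₃‖ with hd
  set t : ℕ → ℝ := fun n ↦ ‖3 * (h n).e₁‖ with ht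
  have hd0 : ∀ n, 0 ≤ d n := fun n ↦ norm_nonneg _
  have hpos : 0 < d 0 := by
    simp only [hd, h0]
    exact norm_pos_iff.2 (sub_ne_zero.2 he.roots.2.2.1)
  have hstart : 17 / 10 * d 0 ≤ t 0 := by
    have hsum := he.sum_eq_zero 0
    have := Triple.parallelogram_lower (a := (e 0).e₁ - (e 0).e₃) (b := (e 0).e₁ - (e 0).e₂)
      (by simpa using he.proper.1) (by simpa using he.proper.1.trans he.proper.2)
    have e1 : (e 0).e₁ - (e 0).e₃ + ((e 0).e₁ - (e 0).e₂) = 3 * (e 0).e₁ := by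
      linear_combination -hsum
    rw [e1] at this
    simpa [hd, ht, h0] using this
  have hstep : ∀ n, 17 / 10 * d n ≤ t n → 0 < d n → 9 * d (n + 1) ≤ d n ∧
      ‖3 * (h (n + 1)).e₁ - 3 * (h n).e₁‖ = 3 * d (n + 1) ∧
      d (n + 1) * (t n / 2 - d n / 4) ≤ d n ^ 2 / 16 := fun n h1 h2 ↦
    (hh n).2.step_bounds (hh (n + 1)).1 h1 h2
  have hdpos : ∀ n, 0 < d n := fun n ↦ norm_pos_iff.2 (sub_ne_zero.2 (he.selection_ne (hh n).1).2.2)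
  -- The surplus `2 / 5 * d n` pays for all later movement of `h₁`: a step costs at most `3 * d (n +
  -- 1)`, and `9 * d (n + 1) ≤ d n`. The invariant keeps the hypothesis of `hstep` alive.
  have hinv : ∀ n, d n ≤ d 0 ∧ 13 / 10 * d 0 + 2 / 5 * d n ≤ t n := by
    intro n
    induction n with
    | zero => exact ⟨le_rfl, by linarith⟩
    | succ n ih =>
      obtain ⟨h1, h2, -⟩ := hstep n (by linarith [ih.1, ih.2]) (hdpos n)
      have h3 : t n ≤ t (n + 1) + 3 * d (n + 1) := by
        rw [← h2, norm_sub_rev]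
        exact norm_le_norm_add_norm_sub' (3 * (h n).e₁) (3 * (h (n + 1)).e₁)
      have := hd0 (n + 1)
      exact ⟨by linarith, by linarith [ih.2]⟩
  have hall := fun n ↦ hstep n (by linarith [(hinv n).1, (hinv n).2]) (hdpos n)
  -- The factor `3` covers `n = 0`, where `rate 0 > 1 / 3`.
  have hrate : ∀ n, d n ≤ 3 * d 0 * rate n := by
    intro n
    induction n with
    | zero => nlinarith [rate_zero_gt]
    | succ n ih =>
      have h1 := (hall n).2.2
      have h2 : d (n + 1) * (3 / 5 * d 0) ≤ d n ^ 2 / 16 :=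
        (mul_le_mul_of_nonneg_left (by linarith [(hinv n).1, (hinv n).2]) (hd0 _)).trans h1
      have h3 : d n ^ 2 ≤ (3 * d 0 * rate n) ^ 2 := by
        have := hd0 n
        gcongr
      rw [rate_succ]
      have h4 : d (n + 1) * (3 / 5 * d 0) ≤ (3 * d 0 * rate n ^ 2) * (3 / 5 * d 0) := by
        nlinarith [mul_nonneg (sq_nonneg (d 0)) (sq_nonneg (rate n))]
      exact le_of_mul_le_mul_right h4 (by positivity)
  have hc : ∀ n, (e (n + 1)).e₁ = -(h n).e₁ / 2 := fun n ↦ (hh n).2.1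
  have ha : ∀ n, ‖(e (n + 1)).sideProd‖ = d n ^ 2 / 16 := by
    intro n
    have := congrArg norm (hh n).2.2.2
    rw [norm_mul, norm_pow, RCLike.norm_ofNat] at this
    rw [Triple.sideProd]
    linarith
  have hr0 := rate_zero_gt
  set C := d 0 ^ 2 + 2 * d 0 + 3 * ‖(e 0).sideProd‖ + 3 * ‖(e 1).e₁ - (e 0).e₁‖ with hC
  have hn1 := norm_nonneg (e 0).sideProd
  have hn2 := norm_nonneg ((e 1).e₁ - (e 0).e₁)
  refine ⟨C, d 0 / 6, by positivity, by positivity, ?_, ?_, ?_⟩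
  · rintro (_ | n)
    · have : 3 * ‖(e 1).e₁ - (e 0).e₁‖ * rate 0 ≤ C * rate 0 := by
        gcongr ?_ * _; rw [hC]; nlinarith
      simp only [zero_add]
      nlinarith
    · have e1 : ‖(e (n + 1 + 1)).e₁ - (e (n + 1)).e₁‖ =
          ‖3 * (h (n + 1)).e₁ - 3 * (h n).e₁‖ / 6 := by
        rw [hc, hc, show 3 * (h (n + 1)).e₁ - 3 * (h n).e₁ =
          -6 * (-(h (n + 1)).e₁ / 2 - -(h n).e₁ / 2) by ring, norm_mul]
        simp
      rw [e1, (hall n).2.1]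
      have : 2 * d 0 * rate (n + 1) ≤ C * rate (n + 1) := by
        gcongr
        · exact (rate_pos _).le
        · rw [hC]; nlinarith
      have := hrate (n + 1)
      nlinarith [mul_pos hpos (rate_pos (n + 1))]
  · rintro (_ | n)
    · have : 3 * ‖(e 0).sideProd‖ * rate 0 ≤ C * rate 0 := by
        gcongr ?_ * _; rw [hC]; nlinarith
      nlinarith
    · rw [ha, rate_succ]
      have : d 0 ^ 2 * rate n ^ 2 ≤ C * rate n ^ 2 := by
        gcongr
        rw [hC]; nlinarith
      have h3 : d n ^ 2 ≤ (3 * d 0 * rate n) ^ 2 := by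
        have := hd0 n
        gcongr; exact hrate n
      nlinarith
  · intro n
    have h1 := (hinv n).2
    have h2 : t n = 3 * ‖(h n).e₁‖ := by simp [ht]
    rw [hc, norm_div, norm_neg]
    simp only [RCLike.norm_ofNat]
    linarith [hd0 n]

/-! ### Homogeneous towers and their convergence. -/

/-- The map `x ↦ x + a / (x - c)` in homogeneous coordinates `x = c + p / q` on the source and
`x = (c - b) + p / q` on the target. -/
def homStep (b a : ℂ) (v : ℂ × ℂ) : ℂ × ℂ :=
  (v.1 ^ 2 + b * v.1 * v.2 + a * v.2 ^ 2, v.1 * v.2)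

/-- `tower c α q k n` is the result, at level `n`, of `k` homogeneous steps starting from the point
`(1, q (n + k))` at level `n + k`. -/
def tower (c α q : ℕ → ℂ) : ℕ → ℕ → ℂ × ℂ
  | 0, n => (1, q n)
  | k + 1, n => homStep (c (n + 1) - c n) (α (n + 1)) (tower c α q k (n + 1))

/-- The defect in the differential equation satisfied by `tower c α q k n`. -/
def towerDefect (c α q : ℕ → ℂ) : ℕ → ℕ → ℂ
  | 0, n => -4 * α n * q n ^ 3
  | k + 1, n => ((tower c α q k (n + 1)).1 ^ 2 - α (n + 1) * (tower c α q k (n + 1)).2 ^ 2) ^ 2 *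
      towerDefect c α q k (n + 1)

section Estimates

variable {c α q : ℕ → ℂ} {B C : ℝ}

theorem tower_succ_fst (k n : ℕ) : (tower c α q (k + 1) n).1 =
    (tower c α q k (n + 1)).1 ^ 2 +
      (c (n + 1) - c n) * (tower c α q k (n + 1)).1 * (tower c α q k (n + 1)).2 +
      α (n + 1) * (tower c α q k (n + 1)).2 ^ 2 := rfl

theorem tower_succ_snd (k n : ℕ) : (tower c α q (k + 1) n).2 =
    (tower c α q k (n + 1)).1 * (tower c α q k (n + 1)).2 := rfl

/-- In `exists_tower_near` an error triples at each step; the factor `6` leaves half of the budget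
for the new perturbation. It fails at `n = 0`. -/
theorem rate_succ_le_div {n : ℕ} (hn : 1 ≤ n) : 6 * rate (n + 1) ≤ rate n := by
  obtain ⟨m, rfl⟩ := Nat.exists_eq_add_of_le' hn
  have h : rate (m + 1) ≤ 4 / 25 := by
    have h0 : ∀ j, rate j ≤ 2 / 5 := by
      intro j
      induction j with
      | zero => exact rate_zero_lt.le
      | succ j ih => exact (rate_succ_le j).trans ih
    rw [rate_succ]
    nlinarith [h0 m, rate_pos m]
  rw [rate_succ (m + 1)]
  nlinarith [rate_pos (m + 1)]

theorem rate_antitone : Antitone rate := antitone_nat_of_succ_le rate_succ_le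

theorem tendsto_rate : Tendsto rate atTop (𝓝 0) :=
  Real.tendsto_exp_atBot.comp (tendsto_neg_atTop_atBot.comp
    (tendsto_pow_atTop_atTop_of_one_lt one_lt_two))

theorem norm_quadratic_le {b a x y : ℂ} {s X Y : ℝ} (hb : ‖b‖ ≤ s) (ha : ‖a‖ ≤ s)
    (hx : ‖x‖ ≤ X) (hy : ‖y‖ ≤ Y) : ‖b * x * y + a * y ^ 2‖ ≤ s * (X * Y + Y ^ 2) := by
  have hs : 0 ≤ s := (norm_nonneg b).trans hb
  have hX : 0 ≤ X := (norm_nonneg x).trans hx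
  have hY : 0 ≤ Y := (norm_nonneg y).trans hy
  calc _ ≤ ‖b‖ * ‖x‖ * ‖y‖ + ‖a‖ * ‖y‖ ^ 2 := by
        refine (norm_add_le _ _).trans_eq ?_
        simp only [norm_mul, norm_pow]
    _ ≤ s * X * Y + s * Y ^ 2 := by gcongr
    _ = _ := by ring

/-- At high levels the tower stays close to its initial value. -/
theorem exists_tower_near (hB : 0 ≤ B) (hC : 0 ≤ C) (hc : ∀ n, ‖c (n + 1) - c n‖ ≤ C * rate n)
    (hα : ∀ n, ‖α n‖ ≤ C * rate n) :
    ∃ n₀, 1 ≤ n₀ ∧ ∀ q : ℕ → ℂ, (∀ n, ‖q n‖ ≤ B) → ∀ k n, n₀ ≤ n →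
      ‖(tower c α q k n).1 - 1‖ ≤ 1 / 2 ∧
      ‖(tower c α q k n).2 - q (n + k)‖ ≤ 1 / 2 * ‖q (n + k)‖ := by
  set K : ℝ := 2 * C * (2 * (2 * B) + (2 * B) ^ 2) with hK
  have hK0 : 0 ≤ K := by positivity
  have hlim : Tendsto (fun n ↦ K * rate n) atTop (𝓝 0) := by simpa using tendsto_rate.const_mul K
  obtain ⟨m, hm⟩ := eventually_atTop.1 (hlim.eventually_le_const (show (0 : ℝ) < 1 / 2 by norm_num))
  refine ⟨m + 1, by omega, fun q hq ↦ ?_⟩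
  -- The second estimate is relative to `q`, so that zeros of the limit can later be compared with
  -- zeros of `sinh`.
  have main : ∀ k n, m + 1 ≤ n → ‖(tower c α q k n).1 - 1‖ ≤ K * rate n ∧
      ‖(tower c α q k n).2 - q (n + k)‖ ≤ K * rate n * ‖q (n + k)‖ := by
    intro k
    induction k with
    | zero =>
      intro n hn
      have := mul_nonneg hK0 (rate_pos n).le
      simp only [tower, sub_self, norm_zero, add_zero]
      exact ⟨this, by positivity⟩
    | succ k ih =>
      intro n hn
      obtain ⟨h1, h2⟩ := ih (n + 1) (by omega)
      have hnk : n + 1 + k = n + (k + 1) := by ring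
      rw [hnk] at h2
      rw [tower_succ_fst, tower_succ_snd]
      set p := (tower c α q k (n + 1)).1
      set r := (tower c α q k (n + 1)).2
      set w := q (n + (k + 1))
      set η := K * rate (n + 1) with hη
      have hη0 : 0 ≤ η := mul_nonneg hK0 (rate_pos _).le
      have hη1 : η ≤ 1 / 2 := hm _ (by omega)
      have hη6 : 6 * η ≤ K * rate n := by
        have := mul_le_mul_of_nonneg_left (rate_succ_le_div (n := n) (by omega)) hK0
        linarith
      have hw : ‖w‖ ≤ B := hq _
      have hp2 : ‖p‖ ≤ 2 := by
        have := norm_le_norm_add_norm_sub' p 1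
        rw [norm_one] at this
        linarith
      have hr : ‖r‖ ≤ 2 * B := by
        have := norm_le_norm_add_norm_sub' r w
        nlinarith [norm_nonneg w]
      have hp1 : ‖p ^ 2 - 1‖ ≤ 3 * η := by
        have e : p ^ 2 - 1 = (p - 1) * (p - 1) + 2 * (p - 1) := by ring
        rw [e]
        refine (norm_add_le _ _).trans ?_
        simp only [norm_mul, RCLike.norm_ofNat]
        nlinarith [norm_nonneg (p - 1)]
      have hquad := norm_quadratic_le (hc n) ((hα (n + 1)).trans
        (mul_le_mul_of_nonneg_left (rate_succ_le n) hC)) hp2 hr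
      constructor
      · calc ‖p ^ 2 + (c (n + 1) - c n) * p * r + α (n + 1) * r ^ 2 - 1‖
            = ‖(p ^ 2 - 1) + ((c (n + 1) - c n) * p * r + α (n + 1) * r ^ 2)‖ := by ring_nf
          _ ≤ 3 * η + C * rate n * (2 * (2 * B) + (2 * B) ^ 2) :=
            (norm_add_le _ _).trans (add_le_add hp1 hquad)
          _ ≤ K * rate n := by
            have : C * rate n * (2 * (2 * B) + (2 * B) ^ 2) = K * rate n / 2 := by rw [hK]; ring
            rw [this]; linarith
      · have e : p * r - w = (p - 1) * (r - w) + (p - 1) * w + (r - w) := by ring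
        rw [e]
        calc _ ≤ ‖p - 1‖ * ‖r - w‖ + ‖p - 1‖ * ‖w‖ + ‖r - w‖ := by
              simpa using norm_add₃_le (a := (p - 1) * (r - w)) (b := (p - 1) * w) (c := r - w)
          _ ≤ η * (η * ‖w‖) + η * ‖w‖ + η * ‖w‖ := by gcongr
          _ = (η ^ 2 + 2 * η) * ‖w‖ := by ring
          _ ≤ K * rate n * ‖w‖ := by gcongr; nlinarith
  intro k n hn
  obtain ⟨h1, h2⟩ := main k n hn
  have := hm n (by omega)
  exact ⟨h1.trans this, h2.trans (by gcongr)⟩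

theorem norm_homStep_sub_le {b a p p' r r' : ℂ} {M d : ℝ} (hM : 1 ≤ M) (hb : ‖b‖ ≤ M)
    (ha : ‖a‖ ≤ M) (hp : ‖p‖ ≤ M) (hp' : ‖p'‖ ≤ M) (hr : ‖r‖ ≤ M) (hr' : ‖r'‖ ≤ M)
    (h1 : ‖p' - p‖ ≤ d) (h2 : ‖r' - r‖ ≤ d) :
    ‖(p' ^ 2 + b * p' * r' + a * r' ^ 2) - (p ^ 2 + b * p * r + a * r ^ 2)‖ ≤ 6 * M ^ 2 * d ∧
      ‖p' * r' - p * r‖ ≤ 6 * M ^ 2 * d := by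
  have hd : 0 ≤ d := (norm_nonneg _).trans h1
  have hMM : M ≤ M ^ 2 := by nlinarith
  have hp2 : ‖p' ^ 2 - p ^ 2‖ ≤ 2 * M * d := by
    rw [show p' ^ 2 - p ^ 2 = (p' + p) * (p' - p) by ring, norm_mul]
    exact mul_le_mul ((norm_add_le _ _).trans (by linarith)) h1 (norm_nonneg _) (by linarith)
  have hr2 : ‖r' ^ 2 - r ^ 2‖ ≤ 2 * M * d := by
    rw [show r' ^ 2 - r ^ 2 = (r' + r) * (r' - r) by ring, norm_mul]
    exact mul_le_mul ((norm_add_le _ _).trans (by linarith)) h2 (norm_nonneg _) (by linarith)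
  have hpr : ‖p' * r' - p * r‖ ≤ 2 * M * d := by
    rw [show p' * r' - p * r = p' * (r' - r) + (p' - p) * r by ring]
    calc _ ≤ ‖p'‖ * ‖r' - r‖ + ‖p' - p‖ * ‖r‖ := by
          simpa using norm_add_le (p' * (r' - r)) ((p' - p) * r)
      _ ≤ M * d + d * M := by gcongr
      _ = _ := by ring
  refine ⟨?_, hpr.trans (by nlinarith)⟩
  rw [show (p' ^ 2 + b * p' * r' + a * r' ^ 2) - (p ^ 2 + b * p * r + a * r ^ 2) =
    (p' ^ 2 - p ^ 2) + b * (p' * r' - p * r) + a * (r' ^ 2 - r ^ 2) by ring]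
  calc _ ≤ ‖p' ^ 2 - p ^ 2‖ + ‖b‖ * ‖p' * r' - p * r‖ + ‖a‖ * ‖r' ^ 2 - r ^ 2‖ := by
        refine norm_add₃_le.trans_eq ?_
        simp only [norm_mul]
    _ ≤ 2 * M * d + M * (2 * M * d) + M * (2 * M * d) := by gcongr
    _ ≤ _ := by nlinarith

/-- Each step costs a Lipschitz factor `L`. Since `n ≥ 1` there are two factors `rate k` to spend:
one absorbs `L ^ k`, the other remains. -/
theorem exists_pow_mul_rate_le (L : ℝ) (hL : 0 ≤ L) {n : ℕ} (hn : 1 ≤ n) :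
    ∃ D, 0 ≤ D ∧ ∀ k, L ^ k * rate (n + k) ≤ D * Real.exp (-1 * 2 ^ k) := by
  have hlim : Tendsto (fun k : ℕ ↦ L ^ k * rate k) atTop (𝓝 0) := by
    obtain ⟨m, hm⟩ := pow_unbounded_of_one_lt L (show (1 : ℝ) < 2 by norm_num)
    refine squeeze_zero (fun k ↦ mul_nonneg (pow_nonneg hL k) (rate_pos k).le) (fun k ↦ ?_)
      ((Real.tendsto_pow_mul_exp_neg_atTop_nhds_zero m).comp
        (tendsto_pow_atTop_atTop_of_one_lt (one_lt_two (α := ℝ))))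
    simp only [Function.comp_apply, rate]
    gcongr
    rw [← pow_mul, mul_comm k, pow_mul]
    gcongr
  obtain ⟨D, hD⟩ := hlim.bddAbove_range
  have hD' : ∀ k, L ^ k * rate k ≤ D := fun k ↦ hD ⟨k, rfl⟩
  refine ⟨D, by simpa using (mul_nonneg (pow_nonneg hL 0) (rate_pos 0).le).trans (hD' 0),
    fun k ↦ ?_⟩
  have h1 : rate (n + k) ≤ rate k ^ 2 := by
    rw [← rate_succ]; exact rate_antitone (by omega)
  have h2 : Real.exp (-1 * 2 ^ k) = rate k := by rw [rate]; ring_nf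
  rw [h2]
  calc L ^ k * rate (n + k) ≤ L ^ k * rate k ^ 2 := by gcongr
    _ = (L ^ k * rate k) * rate k := by ring
    _ ≤ _ := by gcongr; exacts [(rate_pos k).le, hD' k]

theorem norm_defect_factor_le {M : ℝ} {a p r : ℂ} (hM : 1 ≤ M) (ha : ‖a‖ ≤ M) (hp : ‖p‖ ≤ M)
    (hr : ‖r‖ ≤ M) : ‖(p ^ 2 - a * r ^ 2) ^ 2‖ ≤ 4 * M ^ 6 := by
  have h1 : ‖p ^ 2 - a * r ^ 2‖ ≤ 2 * M ^ 3 := by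
    calc _ ≤ ‖p‖ ^ 2 + ‖a‖ * ‖r‖ ^ 2 := by
          refine (norm_sub_le _ _).trans_eq ?_
          simp only [norm_mul, norm_pow]
      _ ≤ M ^ 2 + M * M ^ 2 := by gcongr
      _ ≤ _ := by nlinarith [sq_nonneg M]
  rw [norm_pow]
  calc _ ≤ (2 * M ^ 3) ^ 2 := by gcongr
    _ = _ := by ring

/-- Increments of the tower over a range of levels where it is bounded by `M`. -/
theorem tower_increment_le {M E L : ℝ} {n₀ : ℕ} (hB : 0 ≤ B) (hC : 0 ≤ C)
    (hc : ∀ n, ‖c (n + 1) - c n‖ ≤ C * rate n) (hα : ∀ n, ‖α n‖ ≤ C * rate n)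
    (hM : M = 2 + 2 * B + C) (hE : E = C * (1 * B + B ^ 2) + B + 4 * C * B ^ 3)
    (hL : L = 6 * M ^ 2 + 4 * M ^ 6) (hq : ∀ n, ‖q n‖ ≤ B)
    (hq' : ∀ n, ‖q (n + 1) - q n‖ ≤ B * rate n)
    (tail : ∀ k n, n₀ ≤ n → ‖(tower c α q k n).1‖ ≤ M ∧ ‖(tower c α q k n).2‖ ≤ M) :
    ∀ k n, n₀ ≤ n →
      ‖(tower c α q (k + 1) n).1 - (tower c α q k n).1‖ ≤ L ^ k * (E * rate (n + k)) ∧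
      ‖(tower c α q (k + 1) n).2 - (tower c α q k n).2‖ ≤ L ^ k * (E * rate (n + k)) ∧
      ‖towerDefect c α q k n‖ ≤ L ^ k * (E * rate (n + k)) := by
  have hcC : ∀ n, ‖c (n + 1) - c n‖ ≤ C := fun n ↦
    (hc n).trans (mul_le_of_le_one_right hC (rate_le_one n))
  have hαC : ∀ n, ‖α n‖ ≤ C := fun n ↦ (hα n).trans (mul_le_of_le_one_right hC (rate_le_one n))
  have hM1 : 1 ≤ M := by linarith
  intro k
  induction k with
  | zero =>
    intro n _
    have hr := (rate_pos n).le
    simp only [tower, homStep, towerDefect, pow_zero, one_mul, add_zero, one_pow]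
    refine ⟨?_, (hq' n).trans ?_, ?_⟩
    · have := norm_quadratic_le (hc n) ((hα (n + 1)).trans
        (mul_le_mul_of_nonneg_left (rate_succ_le n) hC)) (norm_one (α := ℂ)).le (hq (n + 1))
      rw [show 1 + (c (n + 1) - c n) * 1 * q (n + 1) + α (n + 1) * q (n + 1) ^ 2 - 1 =
        (c (n + 1) - c n) * 1 * q (n + 1) + α (n + 1) * q (n + 1) ^ 2 by ring]
      refine this.trans ?_
      rw [mul_right_comm]
      gcongr
      rw [hE]; nlinarith [mul_nonneg hC (pow_nonneg hB 3)]
    · gcongr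
      rw [hE]
      nlinarith [mul_nonneg hC (pow_nonneg hB 3), mul_nonneg hC (mul_nonneg hB hB),
        mul_nonneg hC hB]
    · calc _ = 4 * ‖α n‖ * ‖q n‖ ^ 3 := by simp
        _ ≤ 4 * (C * rate n) * B ^ 3 := by gcongr; exacts [hα n, hq n]
        _ = (4 * C * B ^ 3) * rate n := by ring
        _ ≤ _ := by
          gcongr
          rw [hE]; nlinarith [mul_nonneg hC (mul_nonneg hB hB), mul_nonneg hC hB]
  | succ k ih =>
    intro n hn
    -- The towers of heights `k + 2` and `k + 1` at level `n` come from those of heights `k + 1` and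
    -- `k` at level `n + 1` by the same quadratic map, which is Lipschitz on the ball of radius `M`.
    obtain ⟨h1, h2, h3⟩ := ih (n + 1) (by omega)
    have e1 : n + 1 + k = n + (k + 1) := by ring
    rw [e1] at h1 h2 h3
    have t1 := tail k (n + 1) (by omega)
    have t2 := tail (k + 1) (n + 1) (by omega)
    set X := L ^ k * (E * rate (n + (k + 1))) with hX
    have hX0 : 0 ≤ X := (norm_nonneg _).trans h1
    have e2 : L ^ (k + 1) * (E * rate (n + (k + 1))) = L * X := by rw [hX]; ring
    have hM6 : 0 ≤ 4 * M ^ 6 := by positivity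
    have hM2 : 0 ≤ 6 * M ^ 2 := by positivity
    have hle1 : 6 * M ^ 2 * X ≤ L * X := by gcongr; linarith
    have hle2 : 4 * M ^ 6 * X ≤ L * X := by gcongr; linarith
    have hs := norm_homStep_sub_le hM1 ((hcC n).trans (by linarith))
      ((hαC (n + 1)).trans (by linarith)) t1.1 t2.1 t1.2 t2.2 h1 h2
    rw [e2]
    refine ⟨hs.1.trans hle1, hs.2.trans hle1, ?_⟩
    rw [towerDefect, norm_mul]
    exact (mul_le_mul (norm_defect_factor_le hM1 ((hαC (n + 1)).trans (by linarith)) t1.1 t1.2) h3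
      (norm_nonneg _) hM6).trans hle2

/-- Bounds for the tower at level `n`, uniform over initial values bounded by `B` whose increments
are bounded by `B * rate`. -/
def TowerBounded (c α : ℕ → ℂ) (B : ℝ) (n : ℕ) : Prop :=
  ∃ D κ : ℝ, 0 ≤ D ∧ 0 < κ ∧ ∀ q : ℕ → ℂ, (∀ n, ‖q n‖ ≤ B) →
    (∀ n, ‖q (n + 1) - q n‖ ≤ B * rate n) → ∀ k,
      ‖(tower c α q k n).1‖ ≤ D ∧ ‖(tower c α q k n).2‖ ≤ D ∧
      ‖(tower c α q (k + 1) n).1 - (tower c α q k n).1‖ ≤ D * Real.exp (-κ * 2 ^ k) ∧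
      ‖(tower c α q (k + 1) n).2 - (tower c α q k n).2‖ ≤ D * Real.exp (-κ * 2 ^ k) ∧
      ‖towerDefect c α q k n‖ ≤ D * Real.exp (-κ * 2 ^ k)

/-- At high levels closeness to the initial value keeps all towers in one ball, so a single
Lipschitz constant serves every step. -/
theorem exists_towerBounded_of_le (hB : 0 ≤ B) (hC : 0 ≤ C)
    (hc : ∀ n, ‖c (n + 1) - c n‖ ≤ C * rate n) (hα : ∀ n, ‖α n‖ ≤ C * rate n) :
    ∃ n₀, ∀ n, n₀ ≤ n → TowerBounded c α B n := by
  obtain ⟨n₀, hn₀, hnear⟩ := exists_tower_near hB hC hc hα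
  set M : ℝ := 2 + 2 * B + C with hM
  have hM1 : 1 ≤ M := by linarith
  have tail : ∀ q : ℕ → ℂ, (∀ n, ‖q n‖ ≤ B) → ∀ k n, n₀ ≤ n →
      ‖(tower c α q k n).1‖ ≤ M ∧ ‖(tower c α q k n).2‖ ≤ M := by
    intro q hq k n hn
    obtain ⟨h1, h2⟩ := hnear q hq k n hn
    constructor
    · have := norm_le_norm_add_norm_sub' (tower c α q k n).1 1
      rw [norm_one] at this
      linarith
    · have := norm_le_norm_add_norm_sub' (tower c α q k n).2 (q (n + k))
      linarith [hq (n + k)]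
  set E : ℝ := C * (1 * B + B ^ 2) + B + 4 * C * B ^ 3 with hE
  have hE0 : 0 ≤ E := by positivity
  set L : ℝ := 6 * M ^ 2 + 4 * M ^ 6 with hL
  have hL0 : 0 ≤ L := by positivity
  refine ⟨n₀, ?_⟩
  intro n hn
  obtain ⟨D, hD0, hD⟩ := exists_pow_mul_rate_le L hL0 (hn₀.trans hn)
  refine ⟨M + E * D, 1, by positivity, one_pos, fun q hq hq' k ↦ ?_⟩
  have hED : 0 ≤ E * D := by positivity
  have hle : L ^ k * (E * rate (n + k)) ≤ (M + E * D) * Real.exp (-1 * 2 ^ k) := by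
    calc _ = E * (L ^ k * rate (n + k)) := by ring
      _ ≤ E * (D * Real.exp (-1 * 2 ^ k)) := mul_le_mul_of_nonneg_left (hD k) hE0
      _ = (E * D) * Real.exp (-1 * 2 ^ k) := by ring
      _ ≤ _ := by gcongr; linarith
  obtain ⟨d1, d2, d3⟩ := tower_increment_le hB hC hc hα hM hE hL hq hq' (tail q hq) k n hn
  obtain ⟨t1, t2⟩ := tail q hq k n hn
  exact ⟨by linarith, by linarith, d1.trans hle, d2.trans hle, d3.trans hle⟩

/-- Going down one level applies one fixed Lipschitz map on a bounded set. Height `k + 1` at level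
`n` uses height `k` at level `n + 1`, which is why `κ` is halved; only finitely many descents are
needed. -/
theorem TowerBounded.of_succ (hB : 0 ≤ B) (hC : 0 ≤ C)
    (hc : ∀ n, ‖c (n + 1) - c n‖ ≤ C * rate n) (hα : ∀ n, ‖α n‖ ≤ C * rate n) {n : ℕ}
    (ih : TowerBounded c α B (n + 1)) : TowerBounded c α B n := by
  have hcC : ∀ n, ‖c (n + 1) - c n‖ ≤ C := fun n ↦
    (hc n).trans (mul_le_of_le_one_right hC (rate_le_one n))
  have hαC : ∀ n, ‖α n‖ ≤ C := fun n ↦ (hα n).trans (mul_le_of_le_one_right hC (rate_le_one n))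
  obtain ⟨D, κ, hD, hκ, h⟩ := ih
  set N : ℝ := 1 + D + C with hN
  have hN1 : 1 ≤ N := by linarith
  set S : ℝ := 1 + B + 3 * N ^ 3 with hS
  have hS0 : 0 ≤ S := by positivity
  set G : ℝ := 6 * N ^ 2 + 4 * N ^ 6 with hG
  have hG0 : 0 ≤ G * D := by positivity
  -- `X₀` handles `k = 0`: the factor `exp (κ / 2)` cancels the decay required there.
  set X₀ : ℝ := (2 * S + 4 * C * B ^ 3) * Real.exp (κ / 2) with hX₀
  have hX₀0 : 0 ≤ X₀ := by positivity
  refine ⟨S + X₀ + G * D, κ / 2, by positivity, by positivity, fun q hq hq' ↦ ?_⟩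
  have bound : ∀ k, ‖(tower c α q k n).1‖ ≤ S ∧ ‖(tower c α q k n).2‖ ≤ S := by
    have hN3 : 0 ≤ 3 * N ^ 3 := by positivity
    rintro (_ | k)
    · have := hq n
      simp only [tower, norm_one]
      constructor <;> linarith
    · obtain ⟨h1, h2, -⟩ := h q hq hq' k
      have h1' : ‖(tower c α q k (n + 1)).1‖ ≤ N := by linarith
      have h2' : ‖(tower c α q k (n + 1)).2‖ ≤ N := by linarith
      have hNN : N ^ 2 ≤ N ^ 3 := pow_le_pow_right₀ hN1 (by norm_num)
      have h3 := norm_quadratic_le ((hcC n).trans (show C ≤ N by linarith))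
        ((hαC (n + 1)).trans (show C ≤ N by linarith)) h1' h2'
      rw [tower_succ_fst, tower_succ_snd, add_assoc]
      constructor
      · calc _ ≤ N ^ 2 + N * (N * N + N ^ 2) := by
              refine (norm_add_le _ _).trans (add_le_add ?_ h3)
              rw [norm_pow]; gcongr
          _ ≤ _ := by nlinarith
      · calc _ ≤ N * N := by rw [norm_mul]; gcongr
          _ ≤ _ := by nlinarith
  intro k
  refine ⟨(bound k).1.trans (by linarith), (bound k).2.trans (by linarith), ?_⟩
  rcases k with _ | k
  · have e1 : Real.exp (κ / 2) * Real.exp (-(κ / 2) * 2 ^ 0) = 1 := by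
      rw [← Real.exp_add]; simp
    have hd : ‖towerDefect c α q 0 n‖ ≤ 4 * C * B ^ 3 := by
      calc _ = 4 * ‖α n‖ * ‖q n‖ ^ 3 := by simp [towerDefect]
        _ ≤ 4 * C * B ^ 3 := by gcongr; exacts [hαC n, hq n]
    have h1 := (norm_sub_le (tower c α q (0 + 1) n).1 (tower c α q 0 n).1).trans
      (add_le_add (bound 1).1 (bound 0).1)
    have h2 := (norm_sub_le (tower c α q (0 + 1) n).2 (tower c α q 0 n).2).trans
      (add_le_add (bound 1).2 (bound 0).2)
    have hx := Real.exp_pos (-(κ / 2) * 2 ^ 0)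
    have hbig : 2 * S + 4 * C * B ^ 3 ≤ (S + X₀ + G * D) * Real.exp (-(κ / 2) * 2 ^ 0) := by
      calc _ = X₀ * Real.exp (-(κ / 2) * 2 ^ 0) := by
            rw [hX₀]; linear_combination -(2 * S + 4 * C * B ^ 3) * e1
        _ ≤ _ := by gcongr; linarith
    have hCB : 0 ≤ 4 * C * B ^ 3 := by positivity
    exact ⟨by linarith, by linarith, by linarith⟩
  · obtain ⟨h1, h2, h3, h4, h5⟩ := h q hq hq' k
    obtain ⟨h1', h2', -⟩ := h q hq hq' (k + 1)
    have e1 : Real.exp (-(κ / 2) * 2 ^ (k + 1)) = Real.exp (-κ * 2 ^ k) := by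
      congr 1; ring
    rw [e1]
    set X := Real.exp (-κ * 2 ^ k)
    have hX : 0 < X := Real.exp_pos _
    have hs := norm_homStep_sub_le hN1 ((hcC n).trans (by linarith))
      ((hαC (n + 1)).trans (by linarith)) (show _ ≤ N by linarith) (show _ ≤ N by linarith)
      (show _ ≤ N by linarith) (show _ ≤ N by linarith) h3 h4
    have hdef : ‖towerDefect c α q (k + 1) n‖ ≤ 4 * N ^ 6 * (D * X) := by
      rw [towerDefect, norm_mul]
      exact mul_le_mul (norm_defect_factor_le hN1 ((hαC (n + 1)).trans (by linarith)) (by linarith)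
        (by linarith)) h5 (norm_nonneg _) (by positivity)
    have hbig : ∀ y, y ≤ G * (D * X) → y ≤ (S + X₀ + G * D) * X := by
      intro y hy
      rw [← mul_assoc] at hy
      exact hy.trans (mul_le_mul_of_nonneg_right (by linarith) hX.le)
    have p1 : 0 ≤ 4 * N ^ 6 * (D * X) := by positivity
    have p2 : 0 ≤ 6 * N ^ 2 * (D * X) := by positivity
    exact ⟨hbig _ (hs.1.trans (by rw [hG]; linarith)), hbig _ (hs.2.trans (by rw [hG]; linarith)),
      hbig _ (hdef.trans (by rw [hG]; linarith))⟩

theorem towerBounded (hB : 0 ≤ B) (hC : 0 ≤ C)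
    (hc : ∀ n, ‖c (n + 1) - c n‖ ≤ C * rate n) (hα : ∀ n, ‖α n‖ ≤ C * rate n) (n : ℕ) :
    TowerBounded c α B n := by
  obtain ⟨n₀, h⟩ := exists_towerBounded_of_le hB hC hc hα
  rcases le_total n₀ n with hn | hn
  · exact h n hn
  induction hn using Nat.decreasingInduction with
  | self => exact h n₀ le_rfl
  | of_succ n hn ih => exact ih.of_succ hB hC hc hα

/-- A sequence whose increments are doubly exponentially small converges, with the same rate. -/
theorem exists_limit_of_increments {D κ : ℝ} (hκ : 0 < κ) :
    ∃ E, 0 ≤ E ∧ ∀ u : ℕ → ℂ, (∀ k, ‖u (k + 1) - u k‖ ≤ D * Real.exp (-κ * 2 ^ k)) →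
      ∃ l, Tendsto u atTop (𝓝 l) ∧ ∀ k, ‖u k - l‖ ≤ E * Real.exp (-κ * 2 ^ k) := by
  set r := Real.exp (-κ)
  have hr0 : 0 < r := Real.exp_pos _
  have hr1 : r < 1 := Real.exp_lt_one_iff.2 (by linarith)
  -- `2 ^ (k + j) ≥ 2 ^ k + j` reduces the tail to a geometric series. The resulting constant does
  -- not depend on `u`, which later gives uniformity in `z`.
  have hpow : ∀ k j : ℕ, Real.exp (-κ * 2 ^ (k + j)) ≤ Real.exp (-κ * 2 ^ k) * r ^ j := by
    intro k j
    rw [← Real.exp_nat_mul, ← Real.exp_add, Real.exp_le_exp]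
    have h1 : (j : ℝ) + 1 ≤ 2 ^ j := by exact_mod_cast Nat.lt_two_pow_self
    have h2 : (1 : ℝ) ≤ 2 ^ k := one_le_pow₀ (by norm_num)
    have h3 : (2 : ℝ) ^ k + j ≤ 2 ^ k * 2 ^ j := by nlinarith [(Nat.cast_nonneg j : (0 : ℝ) ≤ j)]
    rw [pow_add]
    nlinarith
  refine ⟨|D| * (1 - r)⁻¹, mul_nonneg (abs_nonneg D) (inv_nonneg.2 (by linarith)), fun u hu ↦ ?_⟩
  have hshift : ∀ k j, dist (u (k + j)) (u (k + j + 1)) ≤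
      |D| * Real.exp (-κ * 2 ^ k) * r ^ j := by
    intro k j
    rw [dist_comm, dist_eq_norm]
    calc _ ≤ D * Real.exp (-κ * 2 ^ (k + j)) := hu (k + j)
      _ ≤ |D| * (Real.exp (-κ * 2 ^ k) * r ^ j) :=
        mul_le_mul (le_abs_self D) (hpow k j) (Real.exp_pos _).le (abs_nonneg D)
      _ = _ := by ring
  have hcau : CauchySeq u := by
    refine cauchySeq_of_le_geometric r (|D| * Real.exp (-κ * 2 ^ 0)) hr1 fun j ↦ ?_
    simpa using hshift 0 j
  obtain ⟨l, hl⟩ := cauchySeq_tendsto_of_complete hcau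
  refine ⟨l, hl, fun k ↦ ?_⟩
  have := dist_le_of_le_geometric_of_tendsto₀ r (|D| * Real.exp (-κ * 2 ^ k)) hr1
    (f := fun j ↦ u (k + j)) (hshift k) (a := l)
    (hl.comp (tendsto_atTop_mono (fun j ↦ Nat.le_add_left j k) tendsto_id))
  rw [← dist_eq_norm]
  refine (by simpa using this : dist (u k) l ≤ _).trans_eq ?_
  rw [div_eq_mul_inv, neg_mul]; ring

end Estimates

/-! ### The rank-one function and coherent square roots. -/

/-- The reciprocal `1 / (x - s ^ 2 / 3)` of the rank-one `℘`-function `x` with period `iπ / s`. -/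
noncomputable def sinhSq (s z : ℂ) : ℂ := Complex.sinh (s * z) ^ 2 / s ^ 2

theorem sinhSq_zero (s : ℂ) : sinhSq s 0 = 0 := by simp [sinhSq]

/-- Only `sinh²` enters, so both square roots defining the period give the same value. -/
theorem rankOneP_eq {e : Triple} {w s : ℂ} (hs : s ≠ 0) (hse : s ^ 2 = 3 * e.e₁)
    (hw : IsApproxPeriod e w) :
    w ≠ 0 ∧ ∀ z, sinhSq s z ≠ 0 →
      Complex.sin (Real.pi * z / w) ≠ 0 ∧ rankOneP w z = e.e₁ + 1 / sinhSq s z := by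
  obtain ⟨t, ht, rfl⟩ := hw
  have hpi : (Real.pi : ℂ) ≠ 0 := by exact_mod_cast Real.pi_ne_zero
  have hst : t ^ 2 = s ^ 2 := ht.trans hse.symm
  have ht0 : t ≠ 0 := fun h ↦ hs (by simpa [h] using hst.symm)
  have hsin : ∀ z, Complex.sin (Real.pi * z / (Complex.I * Real.pi / t)) ^ 2 =
      -(s ^ 2 * sinhSq s z) := by
    intro z
    have e1 : Real.pi * z / (Complex.I * Real.pi / t) = -((t * z) * Complex.I) := by
      field_simp
      rw [Complex.I_sq]; ring
    have e2 : Complex.sinh (t * z) ^ 2 = Complex.sinh (s * z) ^ 2 := by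
      rcases sq_eq_sq_iff_eq_or_eq_neg.1 hst with h | h <;> rw [h]
      rw [neg_mul, Complex.sinh_neg]; ring
    rw [e1, Complex.sin_neg, Complex.sin_mul_I, neg_sq, mul_pow, Complex.I_sq, e2, sinhSq]
    field_simp
  refine ⟨div_ne_zero (mul_ne_zero Complex.I_ne_zero hpi) ht0, fun z hz ↦ ?_⟩
  have h1 := hsin z
  refine ⟨fun h ↦ ?_, ?_⟩
  · rw [h] at h1
    have : s ^ 2 * sinhSq s z = 0 := by linear_combination h1
    exact mul_ne_zero (pow_ne_zero 2 hs) hz this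
  · rw [rankOneP, h1, div_pow, mul_pow, Complex.I_sq, hst]
    field_simp
    linear_combination hse * sinhSq s z

/-- This is the case `α = 0` of the differential equation, with `s ^ 2 = 3 * c`. -/
theorem hasDerivAt_sinhSq {s : ℂ} (hs : s ≠ 0) (z : ℂ) :
    ∃ d, HasDerivAt (sinhSq s) d z ∧ d ^ 2 = 4 * sinhSq s z * (1 + s ^ 2 * sinhSq s z) := by
  have h := ((((hasDerivAt_id z).const_mul s).csinh).pow 2).div_const (s ^ 2)
  refine ⟨_, h, ?_⟩
  have hc := Complex.cosh_sq (s * z)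
  simp only [sinhSq, id]
  field_simp
  push_cast
  ring_nf
  rw [hc]
  ring

/-- A `C¹` function is Lipschitz on a compact convex set; the radius `‖s₀‖ / 2` keeps `s` away from
zero. -/
theorem exists_sinhSq_bound {s₀ : ℂ} (hs₀ : s₀ ≠ 0) (R : ℝ) :
    ∃ B : ℝ, 0 ≤ B ∧ ∀ s ∈ Metric.closedBall s₀ (‖s₀‖ / 2), ∀ s' ∈ Metric.closedBall s₀ (‖s₀‖ / 2),
      ∀ z : ℂ, ‖z‖ ≤ R → ‖sinhSq s z‖ ≤ B ∧ ‖sinhSq s' z - sinhSq s z‖ ≤ B * ‖s' - s‖ := by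
  set K : Set (ℂ × ℂ) := Metric.closedBall s₀ (‖s₀‖ / 2) ×ˢ Metric.closedBall (0 : ℂ) R with hK
  have hcomp : IsCompact K := (isCompact_closedBall _ _).prod (isCompact_closedBall _ _)
  have hconv : Convex ℝ K := (convex_closedBall _ _).prod (convex_closedBall _ _)
  have hne : ∀ s ∈ Metric.closedBall s₀ (‖s₀‖ / 2), s ≠ 0 := by
    rintro s hs rfl
    rw [Metric.mem_closedBall, dist_zero_left] at hs
    linarith [norm_pos_iff.2 hs₀]
  have hdiff : ContDiffOn ℝ 1 (fun x : ℂ × ℂ ↦ sinhSq x.1 x.2) K := by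
    refine ContDiffOn.restrict_scalars ℝ (𝕜' := ℂ) ?_
    unfold sinhSq
    refine ContDiffOn.div ?_ (contDiff_fst.pow 2).contDiffOn ?_
    · exact ((contDiff_fst.mul contDiff_snd).csinh.pow 2).contDiffOn
    · rintro x ⟨hx, -⟩
      exact pow_ne_zero 2 (hne _ hx)
  obtain ⟨k, hk⟩ := hdiff.exists_lipschitzOnWith one_ne_zero hconv hcomp
  obtain ⟨b, hb⟩ := hcomp.exists_bound_of_continuousOn hdiff.continuousOn
  refine ⟨max b 0 + k, by positivity, fun s hs s' hs' z hz ↦ ?_⟩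
  have hz' : z ∈ Metric.closedBall (0 : ℂ) R := by simpa using hz
  constructor
  · have := hb (s, z) ⟨hs, hz'⟩
    have h2 := le_max_left b 0
    have h3 := k.coe_nonneg
    exact this.trans (by linarith)
  · have := hk.dist_le_mul (s', z) ⟨hs', hz'⟩ (s, z) ⟨hs, hz'⟩
    rw [dist_eq_norm, Prod.dist_eq, dist_self, max_eq_left dist_nonneg, dist_eq_norm] at this
    exact this.trans (by gcongr; exact le_add_of_nonneg_left (le_max_right _ _))

/-- Square roots of a convergent sequence with nonzero limit, chosen coherently from some index
on. -/
theorem exists_sqrt_seq {c : ℕ → ℂ} {C δ : ℝ} (hδ : 0 < δ)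
    (hc : ∀ n, ‖c (n + 1) - c n‖ ≤ C * rate n) (hδc : ∀ n, δ ≤ ‖c (n + 1)‖) :
    ∃ (m : ℕ) (s : ℕ → ℂ) (s₀ : ℂ) (D : ℝ), s₀ ≠ 0 ∧ 0 ≤ D ∧
      (∀ n, s n ∈ Metric.closedBall s₀ (‖s₀‖ / 2)) ∧ (∀ n, m ≤ n → s n ^ 2 = 3 * c n) ∧
      (∀ n, ‖s (n + 1) - s n‖ ≤ D * rate n) ∧ Tendsto s atTop (𝓝 s₀) := by
  have hrate : ∀ n, rate n = Real.exp (-1 * 2 ^ n) := fun n ↦ by rw [rate]; ring_nf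
  obtain ⟨E, hE, hlim⟩ := exists_limit_of_increments (D := C) one_pos
  obtain ⟨l, hl, hlE⟩ := hlim c (fun n ↦ hrate n ▸ hc n)
  have hl0 : l ≠ 0 := by
    have : δ ≤ ‖l‖ := ge_of_tendsto ((hl.comp (tendsto_add_atTop_nat 1)).norm)
      (Eventually.of_forall hδc)
    exact norm_pos_iff.1 (hδ.trans_le this)
  obtain ⟨s₀, hs₀⟩ := IsAlgClosed.exists_pow_nat_eq (3 * l) two_pos
  have hs0 : s₀ ≠ 0 := by
    rintro rfl
    simp [hl0] at hs₀
  have hpos : 0 < ‖s₀‖ := norm_pos_iff.2 hs0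
  have hex : ∀ n, ∃ t : ℂ, t ^ 2 = 3 * c n ∧ ‖t - s₀‖ ≤ 3 * E / ‖s₀‖ * rate n := by
    intro n
    -- For the root nearer to `s₀` one has `‖t + s₀‖ ≥ ‖s₀‖`, so `(t - s₀) * (t + s₀) = 3 * (c n -
    -- l)` bounds `t - s₀`.
    have key : ∀ t : ℂ, t ^ 2 = 3 * c n → ‖t - s₀‖ ≤ ‖t + s₀‖ →
        ‖t - s₀‖ ≤ 3 * E / ‖s₀‖ * rate n := by
      intro t ht hle
      have h1 : ‖s₀‖ ≤ ‖t + s₀‖ := by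
        have := norm_sub_le (t + s₀) (t - s₀)
        rw [show t + s₀ - (t - s₀) = 2 * s₀ by ring, norm_mul, RCLike.norm_ofNat] at this
        linarith
      have h2 : ‖t - s₀‖ * ‖t + s₀‖ = 3 * ‖c n - l‖ := by
        rw [← norm_mul, show (t - s₀) * (t + s₀) = 3 * (c n - l) by linear_combination ht - hs₀]
        simp
      have h3 := hlE n
      rw [← hrate] at h3
      rw [div_mul_eq_mul_div, le_div_iff₀ hpos]
      calc _ ≤ ‖t - s₀‖ * ‖t + s₀‖ := by gcongr
        _ ≤ _ := by rw [h2]; linarith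
    obtain ⟨t, ht⟩ := IsAlgClosed.exists_pow_nat_eq (3 * c n) two_pos
    rcases le_total ‖t - s₀‖ ‖t + s₀‖ with h | h
    · exact ⟨t, ht, key t ht h⟩
    · refine ⟨-t, by rw [neg_sq, ht], key (-t) (by rw [neg_sq, ht]) ?_⟩
      rw [show -t - s₀ = -(t + s₀) by ring, show -t + s₀ = -(t - s₀) by ring, norm_neg, norm_neg]
      exact h
  choose t ht htE using hex
  set F := 3 * E / ‖s₀‖ with hF
  have hF0 : 0 ≤ F := by positivity
  have hlimF : Tendsto (fun n ↦ F * rate n) atTop (𝓝 0) := by simpa using tendsto_rate.const_mul F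
  obtain ⟨m, hm⟩ := eventually_atTop.1 (hlimF.eventually_le_const (half_pos hpos))
  have htend : Tendsto t atTop (𝓝 s₀) := by
    rw [tendsto_iff_norm_sub_tendsto_zero]
    exact squeeze_zero (fun _ ↦ norm_nonneg _) htE hlimF
  -- Freezing the sequence below `m` keeps every term in the ball, at the price of the equation for
  -- `n < m`.
  refine ⟨m, fun n ↦ t (max n m), s₀, 2 * F, hs0, by positivity, fun n ↦ ?_, fun n hn ↦ ?_,
    fun n ↦ ?_, ?_⟩
  · rw [Metric.mem_closedBall, dist_eq_norm]
    exact (htE _).trans (hm _ (le_max_right _ _))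
  · simpa only [max_eq_left hn] using ht n
  · have h1 : ∀ j, n ≤ j → ‖t j - s₀‖ ≤ F * rate n := fun j hj ↦
      (htE j).trans (mul_le_mul_of_nonneg_left (rate_antitone hj) hF0)
    calc _ = ‖(t (max (n + 1) m) - s₀) - (t (max n m) - s₀)‖ := by ring_nf
      _ ≤ F * rate n + F * rate n := (norm_sub_le _ _).trans
        (add_le_add (h1 _ (by omega)) (h1 _ (by omega)))
      _ = _ := by ring
  · refine htend.congr' ?_
    filter_upwards [eventually_ge_atTop m] with n hn
    simp only [max_eq_left hn]

/-! ### The differential equation and the limit of the tower. -/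

/-- The tower satisfies a perturbed form of the differential equation of `℘`. -/
theorem hasDerivAt_tower {c α s : ℕ → ℂ} {m : ℕ} (hs : ∀ n, s n ≠ 0)
    (hsc : ∀ n, m ≤ n → s n ^ 2 = 3 * c n)
    (hcubic : ∀ n p q p' q', p' = p ^ 2 + (c (n + 1) - c n) * p * q + α (n + 1) * q ^ 2 →
      q' = p * q → p' * q' * (p' ^ 2 + 3 * c n * p' * q' + α n * q' ^ 2) =
        (p ^ 2 - α (n + 1) * q ^ 2) ^ 2 *
          (p * q * (p ^ 2 + 3 * c (n + 1) * p * q + α (n + 1) * q ^ 2))) (z : ℂ) :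
    ∀ k n, ∃ dp dq, HasDerivAt (fun z ↦ (tower c α (fun i ↦ sinhSq (s i) z) k n).1) dp z ∧
      HasDerivAt (fun z ↦ (tower c α (fun i ↦ sinhSq (s i) z) k n).2) dq z ∧
      (m ≤ n + k →
        (dp * (tower c α (fun i ↦ sinhSq (s i) z) k n).2 -
          (tower c α (fun i ↦ sinhSq (s i) z) k n).1 * dq) ^ 2 -
        4 * ((tower c α (fun i ↦ sinhSq (s i) z) k n).1 *
          (tower c α (fun i ↦ sinhSq (s i) z) k n).2 *
          ((tower c α (fun i ↦ sinhSq (s i) z) k n).1 ^ 2 +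
            3 * c n * (tower c α (fun i ↦ sinhSq (s i) z) k n).1 *
              (tower c α (fun i ↦ sinhSq (s i) z) k n).2 +
            α n * (tower c α (fun i ↦ sinhSq (s i) z) k n).2 ^ 2)) =
        towerDefect c α (fun i ↦ sinhSq (s i) z) k n) := by
  intro k
  induction k with
  | zero =>
    intro n
    obtain ⟨d, hd, hd2⟩ := hasDerivAt_sinhSq (hs n) z
    refine ⟨0, d, hasDerivAt_const _ _, hd, fun hn ↦ ?_⟩
    rw [hsc n hn] at hd2
    simp only [tower, towerDefect]
    linear_combination hd2
  | succ k ih =>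
    intro n
    obtain ⟨dp, dq, hp, hq, h⟩ := ih (n + 1)
    refine ⟨_, _, ((hp.pow 2).add ((hp.const_mul (c (n + 1) - c n)).mul hq)).add
      ((hq.pow 2).const_mul (α (n + 1))), hp.mul hq, fun hn ↦ ?_⟩
    have h := h (by omega)
    -- One step multiplies the Wronskian by `p ^ 2 - α * q ^ 2`, the terms with `c (n + 1) - c n`
    -- cancelling; the cubic gains the square of the same factor.
    have hcub := hcubic n _ _ _ _ (tower_succ_fst (c := c) (α := α)
      (q := fun i ↦ sinhSq (s i) z) k n) (tower_succ_snd k n)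
    rw [hcub, towerDefect, ← h, tower_succ_fst, tower_succ_snd]
    push_cast
    ring

theorem tendsto_exp_neg_two_pow {κ : ℝ} (hκ : 0 < κ) :
    Tendsto (fun k : ℕ ↦ Real.exp (-κ * 2 ^ k)) atTop (𝓝 0) := by
  simpa [Function.comp_def, neg_mul] using Real.tendsto_exp_neg_atTop_nhds_zero.comp
    ((tendsto_pow_atTop_atTop_of_one_lt (one_lt_two (α := ℝ))).const_mul_atTop hκ)

/-- Locally uniform convergence from an explicit rate on every disc. -/
theorem tendstoLocallyUniformlyOn_of_rate {f : ℕ → ℂ → ℂ} {g : ℂ → ℂ}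
    (h : ∀ R : ℝ, ∃ E κ : ℝ, 0 < κ ∧ ∀ z : ℂ, ‖z‖ ≤ R → ∀ k,
      ‖f k z - g z‖ ≤ E * Real.exp (-κ * 2 ^ k)) :
    TendstoLocallyUniformlyOn f g atTop Set.univ := by
  rw [Metric.tendstoLocallyUniformlyOn_iff]
  intro ε hε x _
  obtain ⟨E, κ, hκ, hb⟩ := h (‖x‖ + 1)
  refine ⟨Metric.ball x 1, mem_nhdsWithin_of_mem_nhds (Metric.ball_mem_nhds x one_pos), ?_⟩
  have hlim : Tendsto (fun k : ℕ ↦ E * Real.exp (-κ * 2 ^ k)) atTop (𝓝 0) := by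
    simpa using (tendsto_exp_neg_two_pow hκ).const_mul E
  filter_upwards [hlim.eventually_lt_const hε] with k hk y hy
  rw [dist_comm, dist_eq_norm]
  refine (hb y ?_ k).trans_lt hk
  have h1 := norm_le_norm_add_norm_sub' y x
  rw [Metric.mem_ball, dist_eq_norm] at hy
  linarith

/-- The limit of the tower consists of two entire functions `P`, `Q` without common zeros for which
`x = c 0 + P / Q` solves the differential equation attached to `c 0`, `α 0`. -/
theorem exists_tower_limit {c α s : ℕ → ℂ} {m : ℕ} {C D : ℝ} {s₀ : ℂ} (hC : 0 ≤ C)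
    (hc : ∀ n, ‖c (n + 1) - c n‖ ≤ C * rate n) (hα : ∀ n, ‖α n‖ ≤ C * rate n)
    (hα0 : ∀ n, α n ≠ 0)
    (hcubic : ∀ n p q p' q', p' = p ^ 2 + (c (n + 1) - c n) * p * q + α (n + 1) * q ^ 2 →
      q' = p * q → p' * q' * (p' ^ 2 + 3 * c n * p' * q' + α n * q' ^ 2) =
        (p ^ 2 - α (n + 1) * q ^ 2) ^ 2 *
          (p * q * (p ^ 2 + 3 * c (n + 1) * p * q + α (n + 1) * q ^ 2)))
    (hs₀ : s₀ ≠ 0) (hD : 0 ≤ D) (hball : ∀ n, s n ∈ Metric.closedBall s₀ (‖s₀‖ / 2))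
    (hsc : ∀ n, m ≤ n → s n ^ 2 = 3 * c n) (hsD : ∀ n, ‖s (n + 1) - s n‖ ≤ D * rate n)
    (hlim : Tendsto s atTop (𝓝 s₀)) :
    ∃ P Q : ℂ → ℂ, Differentiable ℂ P ∧ Differentiable ℂ Q ∧ P 0 = 1 ∧ Q 0 = 0 ∧
      (∀ᶠ z in 𝓝[≠] 0, Q z ≠ 0) ∧ (∀ z, Q z = 0 → P z ≠ 0) ∧
      (∀ z, (deriv P z * Q z - P z * deriv Q z) ^ 2 =
        4 * (P z * Q z * (P z ^ 2 + 3 * c 0 * P z * Q z + α 0 * Q z ^ 2))) ∧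
      ∀ z, ∃ E κ : ℝ, 0 < κ ∧ ∀ k,
        ‖(tower c α (fun i ↦ sinhSq (s i) z) k 0).1 - P z‖ ≤ E * Real.exp (-κ * 2 ^ k) ∧
        ‖(tower c α (fun i ↦ sinhSq (s i) z) k 0).2 - Q z‖ ≤ E * Real.exp (-κ * 2 ^ k) := by
  have hsne : ∀ n, s n ≠ 0 := by
    intro n hn
    have := hball n
    rw [hn, Metric.mem_closedBall, dist_zero_left] at this
    linarith [norm_pos_iff.2 hs₀]
  set T : ℕ → ℕ → ℂ → ℂ × ℂ := fun n k z ↦ tower c α (fun i ↦ sinhSq (s i) z) k n with hT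
  have hbounded : ∀ R : ℝ, ∃ B, 0 ≤ B ∧ ∀ z : ℂ, ‖z‖ ≤ R →
      (∀ n, ‖sinhSq (s n) z‖ ≤ B) ∧ ∀ n, ‖sinhSq (s (n + 1)) z - sinhSq (s n) z‖ ≤ B * rate n := by
    intro R
    obtain ⟨B, hB, h⟩ := exists_sinhSq_bound hs₀ R
    refine ⟨B + B * D, by positivity, fun z hz ↦ ⟨fun n ↦ ?_, fun n ↦ ?_⟩⟩
    · exact (h _ (hball n) _ (hball n) z hz).1.trans (le_add_of_nonneg_right (by positivity))
    · have hr := (rate_pos n).le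
      calc _ ≤ B * ‖s (n + 1) - s n‖ := (h _ (hball n) _ (hball _) z hz).2
        _ ≤ B * (D * rate n) := by gcongr; exact hsD n
        _ = B * D * rate n := by ring
        _ ≤ _ := by gcongr; exact le_add_of_nonneg_left hB
  -- Every level is needed: nonvanishing is proved at a high level depending on `R` and then carried
  -- down to level zero.
  have hconv : ∀ n (R : ℝ), ∃ E κ : ℝ, 0 < κ ∧ ∀ z : ℂ, ‖z‖ ≤ R → ∃ p q : ℂ,
      Tendsto (fun k ↦ (T n k z).1) atTop (𝓝 p) ∧ Tendsto (fun k ↦ (T n k z).2) atTop (𝓝 q) ∧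
      Tendsto (fun k ↦ towerDefect c α (fun i ↦ sinhSq (s i) z) k n) atTop (𝓝 0) ∧
      ∀ k, ‖(T n k z).1 - p‖ ≤ E * Real.exp (-κ * 2 ^ k) ∧
        ‖(T n k z).2 - q‖ ≤ E * Real.exp (-κ * 2 ^ k) := by
    intro n R
    obtain ⟨B, hB, hz⟩ := hbounded R
    obtain ⟨F, κ, hF, hκ, h⟩ := towerBounded hB hC hc hα n
    obtain ⟨E, hE, hl⟩ := exists_limit_of_increments (D := F) hκ
    refine ⟨E, κ, hκ, fun z hzR ↦ ?_⟩
    have hb := h _ (hz z hzR).1 (hz z hzR).2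
    obtain ⟨p, hp, hp'⟩ := hl (fun k ↦ (T n k z).1) fun k ↦ (hb k).2.2.1
    obtain ⟨q, hq, hq'⟩ := hl (fun k ↦ (T n k z).2) fun k ↦ (hb k).2.2.2.1
    refine ⟨p, q, hp, hq, squeeze_zero_norm (fun k ↦ (hb k).2.2.2.2) ?_, fun k ↦ ⟨hp' k, hq' k⟩⟩
    simpa using (tendsto_exp_neg_two_pow hκ).const_mul F
  have hpt : ∀ n z, ∃ p q : ℂ, Tendsto (fun k ↦ (T n k z).1) atTop (𝓝 p) ∧
      Tendsto (fun k ↦ (T n k z).2) atTop (𝓝 q) := by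
    intro n z
    obtain ⟨_, _, _, h⟩ := hconv n ‖z‖
    obtain ⟨p, q, hp, hq, -⟩ := h z le_rfl
    exact ⟨p, q, hp, hq⟩
  choose P Q hP hQ using hpt
  have hrate : ∀ n (R : ℝ), ∃ E κ : ℝ, 0 < κ ∧ ∀ z : ℂ, ‖z‖ ≤ R →
      ∀ k, ‖(T n k z).1 - P n z‖ ≤ E * Real.exp (-κ * 2 ^ k) ∧
        ‖(T n k z).2 - Q n z‖ ≤ E * Real.exp (-κ * 2 ^ k) := by
    intro n R
    obtain ⟨E, κ, hκ, h⟩ := hconv n R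
    refine ⟨E, κ, hκ, fun z hz k ↦ ?_⟩
    obtain ⟨p, q, hp, hq, -, hpq⟩ := h z hz
    rw [tendsto_nhds_unique (hP n z) hp, tendsto_nhds_unique (hQ n z) hq]
    exact hpq k
  have hderiv := fun z k n ↦ hasDerivAt_tower (α := α) hsne hsc hcubic z k n
  have hPu : ∀ n, TendstoLocallyUniformlyOn (fun k z ↦ (T n k z).1) (P n) atTop Set.univ := by
    refine fun n ↦ tendstoLocallyUniformlyOn_of_rate fun R ↦ ?_
    obtain ⟨E, κ, hκ, h⟩ := hrate n R
    exact ⟨E, κ, hκ, fun z hz k ↦ (h z hz k).1⟩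
  have hQu : ∀ n, TendstoLocallyUniformlyOn (fun k z ↦ (T n k z).2) (Q n) atTop Set.univ := by
    refine fun n ↦ tendstoLocallyUniformlyOn_of_rate fun R ↦ ?_
    obtain ⟨E, κ, hκ, h⟩ := hrate n R
    exact ⟨E, κ, hκ, fun z hz k ↦ (h z hz k).2⟩
  have hTP : ∀ n, ∀ᶠ k in atTop, DifferentiableOn ℂ (fun z ↦ (T n k z).1) Set.univ := by
    refine fun n ↦ Eventually.of_forall fun k z _ ↦ ?_
    obtain ⟨_, _, h, -⟩ := hderiv z k n
    exact h.differentiableAt.differentiableWithinAt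
  have hTQ : ∀ n, ∀ᶠ k in atTop, DifferentiableOn ℂ (fun z ↦ (T n k z).2) Set.univ := by
    refine fun n ↦ Eventually.of_forall fun k z _ ↦ ?_
    obtain ⟨_, _, -, h, -⟩ := hderiv z k n
    exact h.differentiableAt.differentiableWithinAt
  have hPd : ∀ n, Differentiable ℂ (P n) := fun n ↦
    differentiableOn_univ.1 ((hPu n).differentiableOn (hTP n) isOpen_univ)
  have hQd : ∀ n, Differentiable ℂ (Q n) := fun n ↦
    differentiableOn_univ.1 ((hQu n).differentiableOn (hTQ n) isOpen_univ)
  have hPrec : ∀ n z, P n z = P (n + 1) z ^ 2 + (c (n + 1) - c n) * P (n + 1) z * Q (n + 1) z +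
      α (n + 1) * Q (n + 1) z ^ 2 := fun n z ↦
    tendsto_nhds_unique ((hP n z).comp (tendsto_add_atTop_nat 1))
      (((((hP (n + 1) z).pow 2).add (((hP (n + 1) z).const_mul _).mul (hQ (n + 1) z)))).add
        (((hQ (n + 1) z).pow 2).const_mul _))
  have hQrec : ∀ n z, Q n z = P (n + 1) z * Q (n + 1) z := fun n z ↦
    tendsto_nhds_unique ((hQ n z).comp (tendsto_add_atTop_nat 1)) ((hP (n + 1) z).mul (hQ (n + 1) z))
  have hT0 : ∀ k n, T n k 0 = (1, 0) := by
    intro k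
    induction k with
    | zero => intro n; simp [hT, tower, sinhSq_zero]
    | succ k ih =>
      intro n
      have := ih (n + 1)
      simp only [hT] at this
      simp [hT, tower, homStep, this]
  have hP0 : ∀ n, P n 0 = 1 := fun n ↦ tendsto_nhds_unique (hP n 0) (by simp [hT0])
  have hQ0 : ∀ n, Q n 0 = 0 := fun n ↦ tendsto_nhds_unique (hQ n 0) (by simp [hT0])
  have hnear : ∀ R : ℝ, ∃ n₀, ∀ z : ℂ, ‖z‖ ≤ R → ‖P n₀ z - 1‖ ≤ 1 / 2 ∧
      ‖Q n₀ z - sinhSq s₀ z‖ ≤ 1 / 2 * ‖sinhSq s₀ z‖ := by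
    intro R
    obtain ⟨B, hB, hz⟩ := hbounded R
    obtain ⟨n₀, -, h⟩ := exists_tower_near hB hC hc hα
    refine ⟨n₀, fun z hzR ↦ ?_⟩
    have hk := fun k ↦ h _ (hz z hzR).1 k n₀ le_rfl
    have hq : Tendsto (fun k ↦ sinhSq (s (n₀ + k)) z) atTop (𝓝 (sinhSq s₀ z)) := by
      have hs' : Tendsto (fun k ↦ s (n₀ + k)) atTop (𝓝 s₀) :=
        hlim.comp (tendsto_atTop_mono (fun k ↦ Nat.le_add_left k n₀) tendsto_id)
      exact (((Complex.continuous_sinh.tendsto _).comp (hs'.mul_const z)).pow 2).div (hs'.pow 2)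
        (pow_ne_zero 2 hs₀)
    exact ⟨le_of_tendsto ((hP n₀ z).sub_const 1).norm (Eventually.of_forall fun k ↦ (hk k).1),
      le_of_tendsto_of_tendsto ((hQ n₀ z).sub hq).norm (hq.norm.const_mul _)
        (Eventually.of_forall fun k ↦ (hk k).2)⟩
  refine ⟨P 0, Q 0, hPd 0, hQd 0, hP0 0, hQ0 0, ?_, ?_, ?_, ?_⟩
  · obtain ⟨n₀, hn₀⟩ := hnear 1
    have hbase : ∀ᶠ z in 𝓝[≠] 0, Q n₀ z ≠ 0 := by
      have h1 : ∀ᶠ z in 𝓝[≠] (0 : ℂ), Complex.sinh (s₀ * z) ≠ 0 := by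
        have hd : HasDerivAt (fun z ↦ Complex.sinh (s₀ * z)) s₀ 0 := by
          simpa using ((hasDerivAt_id (0 : ℂ)).const_mul s₀).csinh
        simpa using hd.eventually_ne hs₀
      filter_upwards [h1, mem_nhdsWithin_of_mem_nhds (Metric.closedBall_mem_nhds (0 : ℂ) one_pos)]
        with z hz hz1 hq
      have hne : sinhSq s₀ z ≠ 0 := div_ne_zero (pow_ne_zero 2 hz) (pow_ne_zero 2 hs₀)
      have := (hn₀ z (by simpa using hz1)).2
      rw [hq, zero_sub, norm_neg] at this
      linarith [norm_pos_iff.2 hne]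
    have hdown : ∀ n, (∀ᶠ z in 𝓝[≠] 0, Q (n + 1) z ≠ 0) → ∀ᶠ z in 𝓝[≠] 0, Q n z ≠ 0 := by
      intro n h
      have hp : ∀ᶠ z in 𝓝[≠] 0, P (n + 1) z ≠ 0 := by
        refine eventually_nhdsWithin_of_eventually_nhds ?_
        exact (hPd (n + 1)).continuous.continuousAt.eventually_ne (by rw [hP0]; exact one_ne_zero)
      filter_upwards [h, hp] with z h1 h2
      rw [hQrec]
      exact mul_ne_zero h2 h1
    have down : ∀ n, (∀ᶠ z in 𝓝[≠] 0, Q n z ≠ 0) → ∀ᶠ z in 𝓝[≠] 0, Q 0 z ≠ 0 := by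
      intro n
      induction n with
      | zero => exact id
      | succ n ih => exact fun h ↦ ih (hdown n h)
    exact down n₀ hbase
  · intro z
    obtain ⟨n₀, hn₀⟩ := hnear ‖z‖
    have hbase : Q n₀ z = 0 → P n₀ z ≠ 0 := by
      intro _ h
      have := (hn₀ z le_rfl).1
      rw [h, zero_sub, norm_neg, norm_one] at this
      norm_num at this
    have down : ∀ n, (Q n z = 0 → P n z ≠ 0) → (Q 0 z = 0 → P 0 z ≠ 0) := by
      intro n
      induction n with
      | zero => exact id
      | succ n ih =>
        refine fun h ↦ ih fun hq ↦ ?_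
        rw [hPrec]
        rw [hQrec, mul_eq_zero] at hq
        rcases hq with hq | hq
        -- At a zero of `P (n + 1)` the recursion leaves `α (n + 1) * Q ^ 2`, at a zero of `Q (n +
        -- 1)` it leaves `P ^ 2`; the first case uses `α ≠ 0`.
        · have hQne : Q (n + 1) z ≠ 0 := fun h' ↦ h h' hq
          simpa [hq] using ⟨hα0 (n + 1), hQne⟩
        · simpa [hq] using h hq
    exact down n₀ hbase
  · intro z
    have hdP := ((hPu 0).deriv (hTP 0) isOpen_univ).tendsto_at (Set.mem_univ z)
    have hdQ := ((hQu 0).deriv (hTQ 0) isOpen_univ).tendsto_at (Set.mem_univ z)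
    simp only [Function.comp_apply] at hdP hdQ
    have hdef : Tendsto (fun k ↦ towerDefect c α (fun i ↦ sinhSq (s i) z) k 0) atTop (𝓝 0) := by
      obtain ⟨_, _, _, h⟩ := hconv 0 ‖z‖
      obtain ⟨p, q, -, -, hd, -⟩ := h z le_rfl
      exact hd
    have h1 := (((hdP.mul (hQ 0 z)).sub ((hP 0 z).mul hdQ)).pow 2).sub
      ((((hP 0 z).mul (hQ 0 z)).mul ((((hP 0 z).pow 2).add
        (((hP 0 z).const_mul (3 * c 0)).mul (hQ 0 z))).add
          (((hQ 0 z).pow 2).const_mul (α 0)))).const_mul 4)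
    refine sub_eq_zero.1 (tendsto_nhds_unique h1 (hdef.congr' ?_))
    filter_upwards [eventually_ge_atTop m] with k hk
    obtain ⟨dp, dq, hp, hq, h⟩ := hderiv z k 0
    rw [← h (by omega), ← hp.deriv, ← hq.deriv]
  · intro z
    obtain ⟨E, κ, hκ, h⟩ := hrate 0 ‖z‖
    exact ⟨E, κ, hκ, fun k ↦ h z le_rfl k⟩

/-! ### Uniqueness for the differential equation and identification with `℘`. -/

/-- Nonvanishing solutions of `W'² = 4 W (1 + 3 c W + a W²)` with `W(0) = 0` satisfy the regular
second order equation obtained by differentiation. -/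
theorem deriv_deriv_of_ode {W : ℂ → ℂ} {c a : ℂ} (hW : AnalyticAt ℂ W 0) (hW0 : W 0 = 0)
    (hne : ∀ᶠ z in 𝓝[≠] 0, W z ≠ 0)
    (hode : ∀ᶠ z in 𝓝[≠] 0, deriv W z ^ 2 = 4 * (W z * (1 + 3 * c * W z + a * W z ^ 2))) :
    deriv W 0 = 0 ∧ ∀ᶠ z in 𝓝 0, deriv (deriv W) z = 2 + 12 * c * W z + 6 * a * W z ^ 2 := by
  have hcont := hW.continuousAt
  constructor
  · have h := ((hW.deriv.continuousAt.pow 2).eventuallyEq_nhds_iff_eventuallyEq_nhdsNE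
      (g := fun z ↦ 4 * (W z * (1 + 3 * c * W z + a * W z ^ 2))) (by fun_prop)).1 hode
    have := h.eq_of_nhds
    simpa [hW0] using this
  -- Differentiating gives the identity times `2 * W'`. Near the origin but off it `W'` is nonzero
  -- by the equation itself, and continuity restores the origin.
  · refine ((hW.deriv.deriv.continuousAt).eventuallyEq_nhds_iff_eventuallyEq_nhdsNE
      (g := fun z ↦ 2 + 12 * c * W z + 6 * a * W z ^ 2) (by fun_prop)).1 ?_
    have hfac : ∀ᶠ z in 𝓝[≠] 0, 1 + 3 * c * W z + a * W z ^ 2 ≠ 0 := by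
      refine eventually_nhdsWithin_of_eventually_nhds ?_
      have : ContinuousAt (fun z ↦ 1 + 3 * c * W z + a * W z ^ 2) 0 := by fun_prop
      exact this.eventually_ne (by simp [hW0])
    have han : ∀ᶠ z in 𝓝[≠] 0, AnalyticAt ℂ W z :=
      eventually_nhdsWithin_of_eventually_nhds hW.eventually_analyticAt
    filter_upwards [eventually_eventually_nhdsWithin.2 hode, hode, hne, hfac, han,
      self_mem_nhdsWithin] with z hz hz' h1 h2 h3 h4
    rw [isOpen_compl_singleton.nhdsWithin_eq h4] at hz
    have hd1 : HasDerivAt W (deriv W z) z := h3.differentiableAt.hasDerivAt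
    have hd2 : HasDerivAt (deriv W) (deriv (deriv W) z) z := h3.deriv.differentiableAt.hasDerivAt
    have hl := hd2.pow 2
    have hr := (hd1.mul (((hd1.const_mul (3 * c)).const_add 1).add
      ((hd1.pow 2).const_mul a))).const_mul 4
    have heq := hl.unique (hr.congr_of_eventuallyEq hz)
    have hW' : deriv W z ≠ 0 := by
      intro h
      rw [h] at hz'
      have : W z * (1 + 3 * c * W z + a * W z ^ 2) = 0 := by linear_combination -hz' / 4
      exact mul_ne_zero h1 h2 this
    apply mul_left_cancel₀ (mul_ne_zero two_ne_zero hW')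
    simp at heq
    linear_combination heq

/-- Uniqueness of the nonvanishing solution of `W'² = 4 W (1 + 3 c W + a W²)`, `W(0) = 0`. -/
theorem eventuallyEq_of_ode {W V : ℂ → ℂ} {c a : ℂ} (hW : AnalyticAt ℂ W 0) (hV : AnalyticAt ℂ V 0)
    (hW0 : W 0 = 0) (hV0 : V 0 = 0)
    (hWne : ∀ᶠ z in 𝓝[≠] 0, W z ≠ 0) (hVne : ∀ᶠ z in 𝓝[≠] 0, V z ≠ 0)
    (hWode : ∀ᶠ z in 𝓝[≠] 0, deriv W z ^ 2 = 4 * (W z * (1 + 3 * c * W z + a * W z ^ 2)))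
    (hVode : ∀ᶠ z in 𝓝[≠] 0, deriv V z ^ 2 = 4 * (V z * (1 + 3 * c * V z + a * V z ^ 2))) :
    W =ᶠ[𝓝 0] V := by
  obtain ⟨hW1, hW2⟩ := deriv_deriv_of_ode hW hW0 hWne hWode
  obtain ⟨hV1, hV2⟩ := deriv_deriv_of_ode hV hV0 hVne hVode
  have hD : AnalyticAt ℂ (W - V) 0 := hW.sub hV
  -- The difference `D = W - V` satisfies the linear equation `D'' = D * K`.
  set K : ℂ → ℂ := fun z ↦ 12 * c + 6 * a * (W z + V z) with hK
  have hKan : AnalyticAt ℂ K 0 := by fun_prop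
  have hd1 : deriv (W - V) =ᶠ[𝓝 0] deriv W - deriv V := by
    filter_upwards [hW.eventually_analyticAt, hV.eventually_analyticAt] with z h1 h2
    exact deriv_sub h1.differentiableAt h2.differentiableAt
  have hd2 : deriv (deriv (W - V)) =ᶠ[𝓝 0] (W - V) * K := by
    filter_upwards [hd1.deriv, hW.eventually_analyticAt, hV.eventually_analyticAt, hW2, hV2]
      with z h h1 h2 h3 h4
    rw [h, deriv_sub h1.deriv.differentiableAt h2.deriv.differentiableAt, h3, h4]
    simp only [Pi.mul_apply, Pi.sub_apply, hK]
    ring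
  -- As `D` and `D'` vanish at `0`, `ord D = ord D'' + 2 = ord D + ord K + 2`, which forces infinite
  -- order.
  have ho1 : analyticOrderAt (deriv (W - V)) 0 + 1 = analyticOrderAt (W - V) 0 := by
    rw [hD.analyticOrderAt_deriv_add_one]
    congr 1
    ext z
    simp [hW0, hV0]
  have ho2 : analyticOrderAt (deriv (deriv (W - V))) 0 + 1 = analyticOrderAt (deriv (W - V)) 0 := by
    rw [hD.deriv.analyticOrderAt_deriv_add_one]
    congr 1
    ext z
    rw [hd1.eq_of_nhds]
    simp [hW1, hV1]
  rw [analyticOrderAt_congr hd2, analyticOrderAt_mul hD hKan] at ho2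
  rw [← ho2] at ho1
  have htop : analyticOrderAt (W - V) 0 = ⊤ := by
    by_contra hne
    lift analyticOrderAt (W - V) 0 to ℕ using hne with d hd
    rcases eq_or_ne (analyticOrderAt K 0) ⊤ with h | h
    · rw [h] at ho1; simp at ho1
    · lift analyticOrderAt K 0 to ℕ using h with k hk
      norm_cast at ho1
      omega
  filter_upwards [analyticOrderAt_eq_top.1 htop] with z hz
  exact sub_eq_zero.1 hz

/-- Entire functions `P`, `Q` without common zeros for which `c + P / Q` solves the differential
equation of `℘` with the right pole at the origin represent `℘` on the whole plane. -/
theorem weierstrassP_eq_of_ode (L : PeriodPair) {P Q : ℂ → ℂ} {c a : ℂ}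
    (hroots : ∀ x : ℂ, 4 * x ^ 3 - L.g₂ * x - L.g₃ =
      4 * ((x - c) * ((x - c) ^ 2 + 3 * c * (x - c) + a)))
    (hP : Differentiable ℂ P) (hQ : Differentiable ℂ Q) (hP0 : P 0 = 1) (hQ0 : Q 0 = 0)
    (hQne : ∀ᶠ z in 𝓝[≠] 0, Q z ≠ 0) (hPQ : ∀ z, Q z = 0 → P z ≠ 0)
    (hode : ∀ z, (deriv P z * Q z - P z * deriv Q z) ^ 2 =
      4 * (P z * Q z * (P z ^ 2 + 3 * c * P z * Q z + a * Q z ^ 2)))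
    {z : ℂ} (hz : z ∉ L.lattice) : Q z ≠ 0 ∧ L.weierstrassP z = c + P z / Q z := by
  have hPne : ∀ᶠ z in 𝓝 0, P z ≠ 0 :=
    hP.continuous.continuousAt.eventually_ne (by rw [hP0]; exact one_ne_zero)
  have hWan : AnalyticAt ℂ (fun z ↦ Q z / P z) 0 :=
    (hQ.analyticAt 0).div (hP.analyticAt 0) (by rw [hP0]; exact one_ne_zero)
  set E := L.weierstrassPExcept 0 with hE
  have hEan : AnalyticAt ℂ E 0 := L.analyticAt_weierstrassPExcept 0
  have hden : ∀ᶠ z in 𝓝 0, 1 + z ^ 2 * (E z - c) ≠ 0 := by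
    have hc := hEan.continuousAt
    have : ContinuousAt (fun z ↦ 1 + z ^ 2 * (E z - c)) 0 := by fun_prop
    exact this.eventually_ne (by simp)
  -- From `℘ = z⁻² + E` this is `1 / (℘ - c)` continued analytically across the origin.
  set V : ℂ → ℂ := fun z ↦ z ^ 2 / (1 + z ^ 2 * (E z - c)) with hV
  have hVan : AnalyticAt ℂ V 0 := by
    refine AnalyticAt.div (by fun_prop) (by fun_prop) (by simp)
  have hwp : ∀ z, z ≠ 0 → L.weierstrassP z - c = (1 + z ^ 2 * (E z - c)) / z ^ 2 := by
    intro z hz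
    have := L.weierstrassPExcept_add 0 z
    simp only [ZeroMemClass.coe_zero, sub_zero] at this
    rw [← this, hE]
    field_simp
    ring
  have hVeq : ∀ᶠ z in 𝓝[≠] 0, L.weierstrassP z - c ≠ 0 ∧ V z = (L.weierstrassP z - c)⁻¹ := by
    filter_upwards [eventually_nhdsWithin_of_eventually_nhds hden, self_mem_nhdsWithin] with z h1 h2
    rw [hwp z h2, inv_div]
    exact ⟨div_ne_zero h1 (pow_ne_zero 2 h2), rfl⟩
  have hlat : ∀ᶠ z in 𝓝[≠] (0 : ℂ), z ∉ L.lattice := by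
    filter_upwards [mem_nhdsWithin_of_mem_nhds (L.compl_lattice_sdiff_singleton_mem_nhds 0),
      self_mem_nhdsWithin] with z h1 h2 h3
    exact h1 ⟨h3, h2⟩
  have hWode : ∀ᶠ z in 𝓝[≠] 0, deriv (fun z ↦ Q z / P z) z ^ 2 =
      4 * (Q z / P z * (1 + 3 * c * (Q z / P z) + a * (Q z / P z) ^ 2)) := by
    filter_upwards [eventually_nhdsWithin_of_eventually_nhds hPne] with z h
    have hd : deriv (fun z ↦ Q z / P z) z = _ :=
      ((hQ z).hasDerivAt.div (hP z).hasDerivAt h).deriv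
    rw [hd, div_pow]
    have := hode z
    field_simp
    linear_combination this
  have hVode : ∀ᶠ z in 𝓝[≠] 0, deriv V z ^ 2 =
      4 * (V z * (1 + 3 * c * V z + a * V z ^ 2)) := by
    filter_upwards [eventually_eventually_nhdsWithin.2 hVeq, hVeq, hlat, self_mem_nhdsWithin]
      with z h1 h2 h3 h4
    rw [isOpen_compl_singleton.nhdsWithin_eq h4] at h1
    have hd : HasDerivAt L.weierstrassP (L.derivWeierstrassP z) z := by
      rw [← L.deriv_weierstrassP]
      exact (L.analyticOnNhd_weierstrassP z h3).differentiableAt.hasDerivAt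
    have hd' := ((hd.sub_const c).inv h2.1).congr_of_eventuallyEq
      (h1.mono fun y hy ↦ hy.2 : V =ᶠ[𝓝 z] _)
    have hsq := (L.derivWeierstrassP_sq z h3).trans (hroots _)
    rw [hd'.deriv, h2.2, div_pow, neg_sq, hsq]
    have := h2.1
    field_simp
  have heq : (fun z ↦ Q z / P z) =ᶠ[𝓝 0] V := by
    refine eventuallyEq_of_ode hWan hVan (by simp [hQ0]) (by simp [hV]) ?_ ?_ hWode hVode
    · filter_upwards [hQne, eventually_nhdsWithin_of_eventually_nhds hPne] with z h1 h2
      exact div_ne_zero h1 h2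
    · filter_upwards [hVeq] with z h
      rw [h.2]
      exact inv_ne_zero h.1
  have hlocal : ∀ᶠ z in 𝓝[≠] 0, Q z * (L.weierstrassP z - c) = P z := by
    filter_upwards [eventually_nhdsWithin_of_eventually_nhds heq, hVeq,
      eventually_nhdsWithin_of_eventually_nhds hPne] with z h1 h2 h3
    rw [h2.2, div_eq_iff h3] at h1
    rw [h1]
    have := h2.1
    field_simp
  -- The complement of a countable set in the plane is connected, so the identity theorem applies.
  have hcount : (L.lattice : Set ℂ).Countable := by
    have : Countable L.lattice := L.latticeEquivProd.toEquiv.injective.countable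
    exact Set.countable_coe_iff.1 this
  have hconn : IsPreconnected (L.lattice : Set ℂ)ᶜ :=
    (hcount.isConnected_compl_of_one_lt_rank (by simp [Complex.rank_real_complex])).isPreconnected
  obtain ⟨z₀, h1, h2, h3⟩ := ((eventually_eventually_nhdsWithin.2 hlocal).and
    (hlat.and self_mem_nhdsWithin)).exists
  rw [isOpen_compl_singleton.nhdsWithin_eq h3] at h1
  have hglobal : Set.EqOn (fun z ↦ Q z * (L.weierstrassP z - c)) P (L.lattice : Set ℂ)ᶜ :=
    AnalyticOnNhd.eqOn_of_preconnected_of_eventuallyEq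
      (fun y hy ↦ (hQ.analyticAt y).mul ((L.analyticOnNhd_weierstrassP y hy).sub analyticAt_const))
      (fun y _ ↦ hP.analyticAt y) hconn h2 h1
  have hfin : Q z * (L.weierstrassP z - c) = P z := hglobal hz
  have hQz : Q z ≠ 0 := by
    intro h
    rw [h, zero_mul] at hfin
    exact hPQ z h hfin.symm
  refine ⟨hQz, ?_⟩
  rw [← hfin]
  field_simp
  ring

/-! ### Absence of poles and the final estimate. -/

/-- If the second homogeneous coordinate at level `0` does not vanish, no pole is met on the way
down, and `Φ_N` is computed by the tower. -/
theorem phi_tower {e : ℕ → Triple} {q : ℕ → ℂ} :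
    ∀ k n, (tower (fun n ↦ (e n).e₁) (fun n ↦ (e n).sideProd) q k n).2 ≠ 0 → q (n + k) ≠ 0 ∧
      ∀ x, x = (e (n + k)).e₁ + 1 / q (n + k) →
      (PhiFiniteAt e n ((e n).e₁ +
        (tower (fun n ↦ (e n).e₁) (fun n ↦ (e n).sideProd) q k n).1 /
          (tower (fun n ↦ (e n).e₁) (fun n ↦ (e n).sideProd) q k n).2) →
        PhiFiniteAt e (n + k) x) ∧
      Phi e (n + k) x = Phi e n ((e n).e₁ +
        (tower (fun n ↦ (e n).e₁) (fun n ↦ (e n).sideProd) q k n).1 /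
          (tower (fun n ↦ (e n).e₁) (fun n ↦ (e n).sideProd) q k n).2) := by
  intro k
  induction k with
  | zero =>
    intro n hn
    refine ⟨hn, fun x hx ↦ ?_⟩
    subst hx
    exact ⟨id, rfl⟩
  | succ k ih =>
    intro n hn
    set p := (tower (fun n ↦ (e n).e₁) (fun n ↦ (e n).sideProd) q k (n + 1)).1 with hp
    set r := (tower (fun n ↦ (e n).e₁) (fun n ↦ (e n).sideProd) q k (n + 1)).2 with hr
    rw [tower_succ_snd, ← hp, ← hr] at hn ⊢
    rw [tower_succ_fst, ← hp, ← hr]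
    -- The next coordinate is `p * r`: `p ≠ 0` keeps the point off the pole of `φ`, and `r ≠ 0`
    -- keeps it finite.
    have hp0 : p ≠ 0 := left_ne_zero_of_mul hn
    have hr0 : r ≠ 0 := right_ne_zero_of_mul hn
    obtain ⟨hq, h⟩ := ih (n + 1) hr0
    have hidx : n + 1 + k = n + (k + 1) := by ring
    rw [hidx] at hq h
    refine ⟨hq, fun x hx ↦ ?_⟩
    obtain ⟨h1, h2⟩ := h x hx
    have hstep : (e (n + 1)).phi ((e (n + 1)).e₁ + p / r) = (e n).e₁ +
        (p ^ 2 + ((e (n + 1)).e₁ - (e n).e₁) * p * r + (e (n + 1)).sideProd * r ^ 2) / (p * r) := by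
      rw [Triple.phi, ← Triple.sideProd, add_sub_cancel_left]
      field_simp
      ring
    rw [← hstep]
    refine ⟨fun hf ↦ h1 ⟨?_, hf⟩, h2⟩
    simpa using ⟨hp0, hr0⟩

theorem ConvergesQuadratically.of_isBigO {u : ℕ → ℂ} {l : ℂ} {κ : ℝ} (hκ : 0 < κ)
    (h : (fun n ↦ u n - l) =O[atTop] fun n : ℕ ↦ Real.exp (-κ * 2 ^ n)) :
    ConvergesQuadratically u l := by
  refine ⟨tendsto_sub_nhds_zero_iff.1 (h.trans_tendsto (tendsto_exp_neg_two_pow hκ)), ?_⟩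
  -- The comparison sequence never vanishes, so a bound for large `n` extends to all `n`, whatever
  -- default values occur at poles.
  obtain ⟨C, hC, hb⟩ := Asymptotics.bound_of_isBigO_nat_atTop h
  refine ⟨C, κ, hC, hκ, fun n ↦ ?_⟩
  simpa using hb (x := n) (Real.exp_pos _).ne'

/-- Quadratic convergence is inherited by quotients with nonvanishing denominator. -/
theorem isBigO_div_sub_div {p q : ℕ → ℂ} {P Q : ℂ} {g : ℕ → ℝ} (hQ : Q ≠ 0)
    (hg : Tendsto g atTop (𝓝 0)) (hp : (fun n ↦ p n - P) =O[atTop] g)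
    (hq : (fun n ↦ q n - Q) =O[atTop] g) : (fun n ↦ p n / q n - P / Q) =O[atTop] g := by
  have hlim : Tendsto q atTop (𝓝 Q) := tendsto_sub_nhds_zero_iff.1 (hq.trans_tendsto hg)
  have h := (hp.sub (hq.const_mul_left (P / Q))).mul ((hlim.inv₀ hQ).isBigO_one ℝ)
  simp only [mul_one] at h
  refine h.congr' ?_ EventuallyEq.rfl
  filter_upwards [hlim.eventually_ne hQ] with n hn
  field_simp
  ring

/-- The Weierstrass cubic in the coordinate centred at the distinguished root. -/
theorem IsLandenSequence.cubic_eq {g₂ g₃ : ℂ} {e : ℕ → Triple} (he : IsLandenSequence g₂ g₃ e)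
    (x : ℂ) : 4 * x ^ 3 - g₂ * x - g₃ = 4 * ((x - (e 0).e₁) *
      ((x - (e 0).e₁) ^ 2 + 3 * (e 0).e₁ * (x - (e 0).e₁) + (e 0).sideProd)) := by
  have hsum := he.sum_eq_zero 0
  obtain ⟨h12, -, -, r1, r2, -⟩ := he.roots
  have h3 : (e 0).e₃ = -(e 0).e₁ - (e 0).e₂ := by linear_combination hsum
  have hg₂ : g₂ = 4 * ((e 0).e₁ ^ 2 + (e 0).e₁ * (e 0).e₂ + (e 0).e₂ ^ 2) := by
    apply mul_left_cancel₀ (sub_ne_zero.2 h12)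
    linear_combination r2 - r1
  have hg₃ : g₃ = 4 * (e 0).e₁ ^ 3 - g₂ * (e 0).e₁ := by linear_combination -r1
  rw [hg₃, hg₂, Triple.sideProd, h3]
  ring

end WeierstrassLanden

theorem propositionp51 (L : PeriodPair) (e : ℕ → WeierstrassLanden.Triple)
    (he : WeierstrassLanden.IsLandenSequence L.g₂ L.g₃ e)
    (ω : ℕ → ℂ) (hω : ∀ N : ℕ, 1 ≤ N → WeierstrassLanden.IsApproxPeriod (e N) (ω N))
    (z : ℂ) (hz : z ∉ L.lattice) :
    (∀ᶠ N in Filter.atTop, ω N ≠ 0 ∧ Complex.sin (Real.pi * z / ω N) ≠ 0 ∧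
        WeierstrassLanden.PhiFiniteAt e N (WeierstrassLanden.rankOneP (ω N) z)) ∧
      WeierstrassLanden.ConvergesQuadratically
        (fun N => WeierstrassLanden.Phi e N (WeierstrassLanden.rankOneP (ω N) z))
        (L.weierstrassP z) := by
  open WeierstrassLanden in
  obtain ⟨C, δ, hC, hδ, hc, hα, hδc⟩ := he.exists_bounds
  obtain ⟨m, s, s₀, D, hs₀, hD, hball, hsc, hsD, hlim⟩ :=
    exists_sqrt_seq (c := fun n ↦ (e n).e₁) hδ hc hδc
  obtain ⟨h, -, hh⟩ := he.exists_selection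
  obtain ⟨P, Q, hP, hQ, hP0, hQ0, hQne, hPQ, hode, hrate⟩ :=
    exists_tower_limit (c := fun n ↦ (e n).e₁) (α := fun n ↦ (e n).sideProd) hC.le hc hα
      he.sideProd_ne_zero
      (fun n p q p' q' h1 h2 ↦
        (hh n).2.cubic_identity (he.sum_eq_zero n) (hh n).1 h1 h2) hs₀ hD hball hsc hsD hlim
  obtain ⟨hQz, hwp⟩ := weierstrassP_eq_of_ode L he.cubic_eq hP hQ hP0 hQ0 hQne hPQ hode hz
  obtain ⟨E, κ, hκ, hE⟩ := hrate z
  set p := fun k ↦ (tower (fun n ↦ (e n).e₁) (fun n ↦ (e n).sideProd)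
    (fun i ↦ sinhSq (s i) z) k 0).1 with hp
  set q := fun k ↦ (tower (fun n ↦ (e n).e₁) (fun n ↦ (e n).sideProd)
    (fun i ↦ sinhSq (s i) z) k 0).2 with hq
  have hg := tendsto_exp_neg_two_pow hκ
  have hbig : ∀ {u : ℕ → ℂ} {l : ℂ}, (∀ k, ‖u k - l‖ ≤ E * Real.exp (-κ * 2 ^ k)) →
      (fun k ↦ u k - l) =O[Filter.atTop] fun k : ℕ ↦ Real.exp (-κ * 2 ^ k) := fun hu ↦
    Asymptotics.IsBigO.of_bound E (Filter.Eventually.of_forall fun k ↦ by simpa using hu k)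
  have hpO := hbig (u := p) fun k ↦ (hE k).1
  have hqO := hbig (u := q) fun k ↦ (hE k).2
  -- This condition at level zero alone excludes every pole, and also the vanishing of the sine at
  -- level `N`.
  have hqne : ∀ᶠ N in Filter.atTop, q N ≠ 0 :=
    (tendsto_sub_nhds_zero_iff.1 (hqO.trans_tendsto hg)).eventually_ne hQz
  have main : ∀ᶠ N in Filter.atTop, (ω N ≠ 0 ∧ Complex.sin (Real.pi * z / ω N) ≠ 0 ∧
      PhiFiniteAt e N (rankOneP (ω N) z)) ∧
        Phi e N (rankOneP (ω N) z) = (e 0).e₁ + p N / q N := by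
    filter_upwards [hqne, Filter.eventually_ge_atTop m, Filter.eventually_ge_atTop 1]
      with N hN hmN h1N
    have hsN : s N ≠ 0 := by
      intro h0
      have := hball N
      rw [h0, Metric.mem_closedBall, dist_zero_left] at this
      linarith [norm_pos_iff.2 hs₀]
    obtain ⟨hq0, hphi⟩ := phi_tower N 0 hN
    rw [zero_add] at hq0 hphi
    obtain ⟨hω0, hr⟩ := rankOneP_eq hsN (hsc N hmN) (hω N h1N)
    obtain ⟨hsin, hx⟩ := hr z hq0
    obtain ⟨hf, hval⟩ := hphi _ hx
    exact ⟨⟨hω0, hsin, hf trivial⟩, hval⟩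
  refine ⟨main.mono fun N hN ↦ hN.1, ConvergesQuadratically.of_isBigO hκ ?_⟩
  refine (isBigO_div_sub_div hQz hg hpO hqO).congr' ?_ Filter.EventuallyEq.rfl
  filter_upwards [main] with N hN
  rw [hN.2, hwp]
  ring
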